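/- Let $d$ be a natural number and let $\alpha,\lambda,\mu>0$. Let $S$ be the star graph with vertices $0$ and $k_j$ ($k\ge 1$, $1\le j\le d$), with $0_j=0$. Let $N(t)$, $t\ge 0$, be a time-homogeneous Markov process on $S$ with $N(0)=0$ almost surely, whose transition function $p_h(u,v)$ (stochastic, satisfying the Chapman–Kolmogorov equations, $p_0(u,v)=\delta_{uv}$) has the rates $q(u,v)=\lim_{h\to0^+}p_h(u,v)/h$ ($u\ne v$) given by $$q(0,1_j)=\alpha,\qquad q(k_j,(k+1)_j)=\alpha+\lambda k,\qquad q(k_j,(k-1)_j)=\mu k,$$ and $q(u,v)=0$ for all other $u\neq v$, with $\lim_{h\to0^+}(1-p_h(u,u))/h=\sum_{v\ne u}q(u,v)$. Put $p(u,t)=\mathbb P(N(t)=u)$, $P(k,t)=\sum_{j=1}^d p(k_j,t)$ for $k\ge 1$, and $F(z,t)=p(0,t)+\sum_{k\ge1}z^kP(k,t)$. Let $t_{n,j}$ be the number of permutations $\sigma$ of $\{1,\dots,n\}$ with $j$ components, i.e. for which exactly $j$ indices $i\in\{1,\dots,n\}$ satisfy $\sigma(\{1,\dots,i\})=\{1,\dots,i\}$.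 Let $(a)_r=a(a+1)\cdots(a+r-1)$, $(a)_0=1$, and let ${}_2F_1(a,b;c;x)=\sum_{n\ge0}\frac{(a)_n(b)_n}{(c)_n}\frac{x^n}{n!}$ be the Gauss hypergeometric function. If $\mu=\alpha=\lambda$ and $0<t<1/\lambda$, then all series below converge, and: (1) for every $z\in[0,1]$, $$F(z,t)=\frac{1}{1+\lambda t(1-z)}-\frac{\lambda t (d-1)(1-z)}{1+\lambda t (1-z)}\left[1+\sum_{n=1}^{\infty}\frac{(-\lambda t)^n}{n!}\sum_{j=1}^n t_{n,j}\, d^j\right]$$ $$-\frac{(d-1)(1-z)}{[1+\lambda t (1-z)]^2}\sum_{n=1}^{\infty}n \frac{(-\lambda t)^{n+1}}{(n+1)!}\,{}_2F_1\!\left(1,n+1;n+2;1-\frac{1}{1+\lambda t (1-z)}\right) \sum_{j=1}^n t_{n,j}\, d^j;$$ (2) for every integer $k\ge1$, $$P(k,t)=\frac{(\lambda t)^k}{(\lambda t+1)^{k+1}}\left\{d+(d-1) \sum_{n=1}^{\infty} \left[\frac{(-\lambda t)^{n}}{n!}\sum_{j=1}^n t_{n,j}\, d^j\right]\sum_{r=0}^{\infty}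 \frac{(n)_r}{(n+1)_r}\left(1-\frac{1}{1+\lambda t}\right)^r{}_2F_1\!\left(-r,-k;1;-\frac{1}{\lambda t}\right)\right\}.$$ -/

import Mathlib

open Filter Topology MeasureTheory

/-- The vertices of the star graph with `d` rays: `none` is the common origin `0`, and
`some (j, k)` is the vertex `k_j`, the `k`-th vertex (`k ≥ 1`) of the `j`-th ray. -/
abbrev StarState (d : ℕ) : Type := Option (Fin d × ℕ+)

/-- The rate `q(u, v)` of the jumps from `u` to `v ≠ u`, for the immigration rate `al`,
the birth rate `lam` and the death rate `mu`: `q(0, 1_j) = al`, `q(k_j, (k+1)_j) = al + lam * k`,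
`q(k_j, (k-1)_j) = mu * k` (where `0_j = 0`), and no other jumps. -/
def starRate (d : ℕ) (al lam mu : ℝ) : StarState d → StarState d → ℝ
  | none, none => 0
  | none, some (_, k) => if k = 1 then al else 0
  | some (_, k), none => if k = 1 then mu else 0
  | some (i, k), some (j, l) =>
      if i = j then
        if l = k + 1 then al + lam * (k : ℝ) else if k = l + 1 then mu * (k : ℝ) else 0
      else 0

/-- The total rate at which the vertex `u` is left, see `hasSum_starRate`. -/
def starExitRate (d : ℕ) (al lam mu : ℝ) : StarState d → ℝ
  | none => d * al
  | some (_, k) => al + (lam + mu) * (k : ℝ)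

theorem hasSum_starRate (d : ℕ) (al lam mu : ℝ) (u : StarState d) :
    HasSum (starRate d al lam mu u) (starExitRate d al lam mu u) := by
  classical
  rcases u with _ | ⟨i, k⟩
  · have h := hasSum_sum_of_ne_finset_zero (L := SummationFilter.unconditional _) (f := starRate d al lam mu none)
      (s := Finset.univ.image (fun j : Fin d => (some (j, 1) : StarState d))) (by
        rintro (_ | ⟨j, l⟩) hv
        · rfl
        · have hl : l ≠ 1 := by
            rintro rfl
            exact hv (Finset.mem_image_of_mem _ (Finset.mem_univ j))
          simp [starRate, hl])
    rw [Finset.sum_image (by intro a _ b _ hab; simpa using hab)] at h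
    simpa [starRate, starExitRate] using h
  · by_cases hk : k = 1
    · subst hk
      have h := hasSum_sum_of_ne_finset_zero (L := SummationFilter.unconditional _) (f := starRate d al lam mu (some (i, 1)))
        (s := {none, some (i, 1 + 1)}) (by
          rintro (_ | ⟨j, l⟩) hv
          · simp at hv
          · by_cases hij : i = j
            · subst hij
              have h1 : l ≠ 1 + 1 := by rintro rfl; simp at hv
              have h2 : (1 : ℕ+) ≠ l + 1 := by
                intro h; have := congrArg PNat.val h; have := l.pos; simp at *
              simp only [starRate, h1, h2, if_true, if_false]
            · simp [starRate, hij])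
      rw [Finset.sum_pair (by simp)] at h
      convert h using 1
      simp [starRate, starExitRate]
      ring
    · obtain ⟨m, rfl⟩ : ∃ m : ℕ+, k = m + 1 := PNat.exists_eq_succ_of_ne_one hk
      have hne : m ≠ m + 1 + 1 := by
        intro h; have := congrArg PNat.val h; simp at this; omega
      have h := hasSum_sum_of_ne_finset_zero (L := SummationFilter.unconditional _) (f := starRate d al lam mu (some (i, m + 1)))
        (s := {some (i, m), some (i, m + 1 + 1)}) (by
          rintro (_ | ⟨j, l⟩) hv
          · simp [starRate, hk]
          · by_cases hij : i = j
            · subst hij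
              have h1 : l ≠ m + 1 + 1 := by rintro rfl; simp at hv
              have h2 : m + 1 ≠ l + 1 := by
                intro h; apply hv; simp [add_right_cancel h]
              simp only [starRate, h1, h2, if_true, if_false]
            · simp [starRate, hij])
      rw [Finset.sum_pair (by simpa using hne)] at h
      convert h using 1
      simp only [starRate, starExitRate, if_true, if_neg hne]
      ring

/-- `P h u v`, `h ≥ 0`, is a (stochastic) transition function on the star graph with the
transition rates above: `P h u v = q(u, v) h + o(h)` for `v ≠ u` and
`P h u u = 1 - (∑ v, q(u, v)) h + o(h)` as `h → 0+`. -/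
structure IsStarTransition (d : ℕ) (al lam mu : ℝ)
    (P : ℝ → StarState d → StarState d → ℝ) : Prop where
  nonneg : ∀ h, 0 ≤ h → ∀ u v, 0 ≤ P h u v
  hasSum_one : ∀ h, 0 ≤ h → ∀ u, HasSum (P h u) 1
  zero : ∀ u v, P 0 u v = if u = v then 1 else 0
  chapman_kolmogorov : ∀ s t, 0 ≤ s → 0 ≤ t → ∀ u v,
    HasSum (fun w => P s u w * P t w v) (P (s + t) u v)
  rate : ∀ u v, u ≠ v →
    Tendsto (fun h => P h u v / h) (𝓝[>] 0) (𝓝 (starRate d al lam mu u v))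
  exit_rate : ∀ u,
    Tendsto (fun h => (1 - P h u u) / h) (𝓝[>] 0) (𝓝 (starExitRate d al lam mu u))

/-- `N t`, `t ≥ 0`, is a time-homogeneous Markov process on the star graph with the transition
rates above that starts at the origin. (Values of `N` at negative times play no role.) The field
`markov` says that, given `N t = u` and the values of `N` at finitely many times before `t`,
the probability that `N (t + h) = v` is `P h u v`. -/
structure IsStarWalk (d : ℕ) (al lam mu : ℝ) {Ω : Type*} [MeasurableSpace Ω]
    (ℙ : Measure Ω) (N : ℝ → Ω → StarState d) : Prop where
  measurable : ∀ t, 0 ≤ t → ∀ u, MeasurableSet {ω | N t ω = u}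
  start : ∀ᵐ ω ∂ℙ, N 0 ω = none
  markov : ∃ P, IsStarTransition d al lam mu P ∧
    ∀ (n : ℕ) (s : Fin n → ℝ) (x : Fin n → StarState d) (t h : ℝ) (u v : StarState d),
      (∀ i, 0 ≤ s i ∧ s i ≤ t) → 0 ≤ t → 0 ≤ h →
      ℙ.real {ω | (∀ i, N (s i) ω = x i) ∧ N t ω = u ∧ N (t + h) ω = v} =
        ℙ.real {ω | (∀ i, N (s i) ω = x i) ∧ N t ω = u} * P h u v

section walk

variable {d : ℕ} {Ω : Type*} [MeasurableSpace Ω]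

/-- `p(u, t)`, the probability that the walk is at `u` at time `t`. -/
noncomputable def walkProb (ℙ : Measure Ω) (N : ℝ → Ω → StarState d) (u : StarState d)
    (t : ℝ) : ℝ :=
  ℙ.real {ω | N t ω = u}

/-- `P(k, t) = ∑ j, p(k_j, t)`. -/
noncomputable def levelProb (ℙ : Measure Ω) (N : ℝ → Ω → StarState d) (k : ℕ+) (t : ℝ) : ℝ :=
  ∑ j : Fin d, walkProb ℙ N (some (j, k)) t

/-- The probability generating function `F(z, t) = p(0, t) + ∑_{k ≥ 1} z ^ k P(k, t)`. -/
noncomputable def walkGenFun (ℙ : Measure Ω) (N : ℝ → Ω → StarState d) (z t : ℝ) : ℝ :=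
  walkProb ℙ N none t + ∑' k : ℕ+, z ^ (k : ℕ) * levelProb ℙ N k t

end walk

/-- The number of components of a permutation `σ` of `{0, …, n - 1}`: the number of `i` for which
`σ` maps the initial segment `{0, …, i}` to itself. -/
def permComponents {n : ℕ} (σ : Equiv.Perm (Fin n)) : ℕ :=
  (Finset.univ.filter fun i : Fin n => ∀ j, j ≤ i → σ j ≤ i).card

/-- `t_{n,k}`, the number of permutations of an `n`-element chain with `k` components. -/
def permCount (n k : ℕ) : ℕ :=
  (Finset.univ.filter fun σ : Equiv.Perm (Fin n) => permComponents σ = k).card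

/-- `∑_{j=1}^n t_{n,j} d^j`. -/
noncomputable def permPoly (d n : ℕ) : ℝ :=
  ∑ j ∈ Finset.Icc 1 n, (permCount n j : ℝ) * (d : ℝ) ^ j

/-! With a single ray and all rates equal to λ, the distance from the origin is a critical linear
birth and death process with immigration, and its generating function at `z = 1 - w` is the explicit
`critGen`. With `d` rays the distance obeys the same backward equation except at the origin, which
is left at rate `dλ` instead of `λ`. Differentiating in `s` the expectation at time `s` of `critGen`
for the remaining time `t - s` therefore leaves only a term at the origin. Integration gives
Duhamel's formula `expect_pow_level`: `F(1-w,t) = 1/(1+λwt) - (d-1)λw ∫₀ᵗ p(0,s)/(1+λw(t-s))² ds`.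
Differentiating the infinite sum needs a finite first moment of the distance. The transition
function is known only through its rates at time `0`, so that moment comes from a maximum principle
(`expect_le_of_le_level`).

At `w = 1` Duhamel's formula is a Volterra equation for `p(0,·)`. When the kernel is expanded in
powers, Beta integrals turn this equation into a recurrence for Taylor coefficients. It is the
recurrence of the permutations weighted by `d` to the number of components (`permSum_recurrence`,
obtained by cutting a permutation at a break). Hence `p(0,t)` is their exponential generating
function at `-λt`. The bound `permSum_le` gives convergence for `λt < 1`, and uniqueness for the
Volterra equation gives the identification (`apply_none_none`).

Integrating this series term by term in Duhamel's formula yields (1). For (2), an integration by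
parts replaces the squared kernel by `1/(1+λ(1-z)(t-s))`, the generating function of the one-ray law
`critProb`, so that coefficients of `z^k` can be compared (`level_eq`). The inner sum over `r` in
(2) is the resulting integral of `critProb`, expanded in powers of `s/t`
(`hasSum_hypergeometric_coeff`). -/

/-! ### Permutations weighted by their number of components. -/

theorem pow_card_eq_one_add_sum {ι R : Type*} [LinearOrder ι] [CommRing R] (q : R)
    (B : Finset ι) :
    q ^ B.card = 1 + (q - 1) * ∑ i ∈ B, q ^ (B.filter (i < ·)).card := by
  -- The sum is geometric: the exponents run through `0, …, |B| - 1`. Adding a new minimum leaves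
  -- the old exponents unchanged and contributes the top one.
  induction B using Finset.induction_on_min with
  | empty => simp
  | insert a s ha ih =>
    have hns : a ∉ s := fun h => lt_irrefl _ (ha a h)
    have h1 : (insert a s).filter (a < ·) = s := by
      ext x
      simp only [Finset.mem_filter, Finset.mem_insert]
      constructor
      · rintro ⟨rfl | h, h'⟩
        · exact absurd h' (lt_irrefl _)
        · exact h
      · exact fun h => ⟨Or.inr h, ha x h⟩
    have h2 : ∀ i ∈ s, q ^ ((insert a s).filter (i < ·)).card = q ^ (s.filter (i < ·)).card := by
      intro i hi
      rw [Finset.filter_insert, if_neg (ha i hi).not_gt]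
    rw [Finset.card_insert_of_notMem hns, Finset.sum_insert hns, h1, Finset.sum_congr rfl h2,
      mul_add, pow_succ]
    linear_combination ih

/-- The set of the ends of the components of a permutation. -/
def permBreaks {n : ℕ} (σ : Equiv.Perm (Fin n)) : Finset (Fin n) :=
  Finset.univ.filter fun i : Fin n => ∀ j, j ≤ i → σ j ≤ i

/-- The generating polynomial of the number of components of permutations. -/
noncomputable def permSum (q : ℝ) (n : ℕ) : ℝ :=
  ∑ σ : Equiv.Perm (Fin n), q ^ permComponents σ

theorem permSum_zero (q : ℝ) : permSum q 0 = 1 := by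
  simp [permSum, permComponents]

/-- The last index always ends a component, so `j = 0` does not occur for `n > 0`. At `n = 0` the
two sides differ: the empty sum is `0`, while the empty permutation contributes `1`. -/
theorem permPoly_eq_permSum (d : ℕ) {n : ℕ} (hn : 0 < n) : permPoly d n = permSum d n := by
  have hm : ∀ σ ∈ (Finset.univ : Finset (Equiv.Perm (Fin n))),
      permComponents σ ∈ Finset.Icc 1 n := by
    intro σ _
    rw [Finset.mem_Icc]
    constructor
    · refine Finset.card_pos.mpr ⟨⟨n - 1, by omega⟩, ?_⟩
      simp only [Finset.mem_filter, Finset.mem_univ, true_and]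
      intro j _
      rw [Fin.le_def]
      have := (σ j).isLt
      simp only
      omega
    · exact (Finset.card_le_univ _).trans (by simp)
  rw [permPoly, permSum, ← Finset.sum_fiberwise_of_maps_to hm]
  refine Finset.sum_congr rfl fun j _ => ?_
  rw [permCount, Finset.sum_congr rfl (g := fun _ => (d : ℝ) ^ j), Finset.sum_const, nsmul_eq_mul]
  intro σ hσ
  rw [(Finset.mem_filter.mp hσ).2]

/-- Permutations of two consecutive blocks, combined. -/
def permAppend {a m : ℕ} (p : Equiv.Perm (Fin a) × Equiv.Perm (Fin m)) :
    Equiv.Perm (Fin (a + m)) :=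
  finSumFinEquiv.permCongr (Equiv.sumCongr p.1 p.2)

theorem permAppend_castAdd {a m : ℕ} (p : Equiv.Perm (Fin a) × Equiv.Perm (Fin m)) (i : Fin a) :
    permAppend p (Fin.castAdd m i) = Fin.castAdd m (p.1 i) := by
  simp [permAppend, Equiv.permCongr_apply]

theorem permAppend_natAdd {a m : ℕ} (p : Equiv.Perm (Fin a) × Equiv.Perm (Fin m)) (i : Fin m) :
    permAppend p (Fin.natAdd a i) = Fin.natAdd a (p.2 i) := by
  simp [permAppend, Equiv.permCongr_apply]

theorem permAppend_injective {a m : ℕ} : Function.Injective (@permAppend a m) := by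
  intro p q h
  refine Prod.ext (Equiv.ext fun i => ?_) (Equiv.ext fun i => ?_)
  · have := congrArg (fun e => e (Fin.castAdd m i)) h
    simpa [permAppend_castAdd] using this
  · have := congrArg (fun e => e (Fin.natAdd a i)) h
    simpa [permAppend_natAdd] using this

theorem exists_permAppend_eq {a m : ℕ} (σ : Equiv.Perm (Fin (a + m)))
    (h : ∀ j : Fin (a + m), (j : ℕ) < a → (σ j : ℕ) < a) : ∃ p, permAppend p = σ := by
  have h1 : Set.MapsTo (finSumFinEquiv.symm.permCongr σ)
      (Set.range Sum.inl) (Set.range (Sum.inl : Fin a → Fin a ⊕ Fin m)) := by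
    rintro _ ⟨i, rfl⟩
    have h2 := h (Fin.castAdd m i) (by simp)
    refine ⟨⟨_, h2⟩, ?_⟩
    simp only [Equiv.permCongr_apply, Equiv.symm_symm, finSumFinEquiv_apply_left]
    rw [Equiv.eq_symm_apply]
    simp
  obtain ⟨p, hp⟩ := Equiv.Perm.mem_sumCongrHom_range_of_perm_mapsTo_inl h1
  refine ⟨p, ?_⟩
  ext j
  have h3 : Equiv.sumCongr p.1 p.2 = finSumFinEquiv.symm.permCongr σ := hp
  rw [permAppend, h3]
  simp [Equiv.permCongr_apply]

/-- An initial segment containing the whole first block is preserved exactly when its trace on the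
second block is, so the first permutation plays no role. -/
theorem card_filter_permBreaks_permAppend {a m : ℕ}
    (p : Equiv.Perm (Fin a) × Equiv.Perm (Fin m)) :
    ((permBreaks (permAppend p)).filter fun j : Fin (a + m) => a ≤ (j : ℕ)).card = permComponents p.2 := by
  symm
  refine Finset.card_bij (fun i _ => Fin.natAdd a i) ?_ ?_ ?_
  · intro i hi
    simp only [Finset.mem_filter, Finset.mem_univ, true_and, permBreaks] at hi ⊢
    refine ⟨fun j => ?_, by simp⟩
    refine Fin.addCases (fun l => ?_) (fun l => ?_) j
    · intro _
      rw [permAppend_castAdd, Fin.le_def]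
      simp only [Fin.val_castAdd, Fin.val_natAdd]
      omega
    · intro hl
      rw [permAppend_natAdd]
      simpa using hi l (by simpa using hl)
  · intro i _ j _ h
    simpa using h
  · intro j hj
    simp only [Finset.mem_filter, Finset.mem_univ, true_and, permBreaks] at hj
    revert hj
    refine Fin.addCases (fun l => ?_) (fun l => ?_) j
    · rintro ⟨_, h⟩
      simp only [Fin.val_castAdd] at h
      omega
    · rintro ⟨h, _⟩
      refine ⟨l, ?_, rfl⟩
      simp only [Finset.mem_filter, Finset.mem_univ, true_and]
      intro i hi
      have := h (Fin.natAdd a i) (by simpa using hi)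
      rw [permAppend_natAdd] at this
      simpa using this

theorem sum_filter_preserving (q : ℝ) (n a m : ℕ) (h : n = a + m) :
    (∑ σ : Equiv.Perm (Fin n) with (∀ j : Fin n, (j : ℕ) < a → (σ j : ℕ) < a),
      q ^ ((permBreaks σ).filter fun j : Fin n => a ≤ (j : ℕ)).card) = (a.factorial : ℝ) * permSum q m := by
  subst h
  have h1 : (Finset.univ : Finset (Equiv.Perm (Fin (a + m)))).filter
      (fun σ => ∀ j : Fin (a + m), (j : ℕ) < a → (σ j : ℕ) < a) =
      Finset.univ.image permAppend := by
    ext σ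
    simp only [Finset.mem_filter, Finset.mem_univ, true_and, Finset.mem_image]
    constructor
    · exact exists_permAppend_eq σ
    · rintro ⟨p, rfl⟩ j
      refine Fin.addCases (fun l => ?_) (fun l => ?_) j
      · intro _
        rw [permAppend_castAdd]
        simp
      · intro h
        simp only [Fin.val_natAdd] at h
        omega
  rw [h1, Finset.sum_image permAppend_injective.injOn]
  simp only [card_filter_permBreaks_permAppend]
  rw [← Finset.univ_product_univ, Finset.sum_product]
  simp [permSum, Fintype.card_perm]

/-- Expand `q ^ components` by `pow_card_eq_one_add_sum` and sum over permutations first. Those with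
a break at `i` consist of an arbitrary permutation of the first `i + 1` points, hence the factorial,
and a permutation of the rest whose breaks are precisely the later ones. -/
theorem permSum_recurrence (q : ℝ) (n : ℕ) :
    permSum q n = (n.factorial : ℝ) +
      (q - 1) * ∑ i ∈ Finset.range n, ((i + 1).factorial : ℝ) * permSum q (n - 1 - i) := by
  have h0 : ∀ σ : Equiv.Perm (Fin n), q ^ permComponents σ = 1 + (q - 1) *
      ∑ i ∈ permBreaks σ, q ^ ((permBreaks σ).filter (i < ·)).card :=
    fun σ => pow_card_eq_one_add_sum q (permBreaks σ)
  rw [permSum, Finset.sum_congr rfl fun σ _ => h0 σ, Finset.sum_add_distrib, ← Finset.mul_sum]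
  congr 1
  · simp [Fintype.card_perm]
  congr 1
  rw [← Fin.sum_univ_eq_sum_range (fun i => ((i + 1).factorial : ℝ) * permSum q (n - 1 - i))]
  rw [Finset.sum_comm' (t' := Finset.univ) (s' := fun i : Fin n => Finset.univ.filter
    fun σ : Equiv.Perm (Fin n) => ∀ j : Fin n, (j : ℕ) < i + 1 → (σ j : ℕ) < i + 1)]
  · refine Finset.sum_congr rfl fun i _ => ?_
    rw [← sum_filter_preserving q n (i + 1) (n - 1 - i) (by have := i.isLt; omega)]
    rfl
  · intro σ i
    simp only [permBreaks, Finset.mem_filter, Finset.mem_univ, true_and, and_true,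
      Nat.lt_succ_iff, Fin.le_def]

theorem permSum_nonneg {q : ℝ} (hq : 0 ≤ q) (n : ℕ) : 0 ≤ permSum q n :=
  Finset.sum_nonneg fun _ _ => pow_nonneg hq _

theorem factorial_succ_mul_factorial_le {i m : ℕ} (hm : 0 < m) :
    (i + 1).factorial * m.factorial ≤ (i + m).factorial := by
  obtain ⟨m, rfl⟩ : ∃ k, m = k + 1 := ⟨m - 1, by omega⟩
  induction m with
  | zero => simp
  | succ m ih =>
    have := ih (by omega)
    rw [Nat.factorial_succ (m + 1), show i + (m + 1 + 1) = (i + (m + 1)) + 1 by ring,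
      Nat.factorial_succ (i + (m + 1))]
    calc (i + 1).factorial * ((m + 1 + 1) * (m + 1).factorial)
        = (m + 1 + 1) * ((i + 1).factorial * (m + 1).factorial) := by ring
      _ ≤ (i + (m + 1) + 1) * (i + (m + 1)).factorial := Nat.mul_le_mul (by omega) this

/-- Polynomial growth relative to `n!` suffices for radius of convergence `1`. The binomial shape is
chosen because it is stable under the recurrence: `factorial_succ_mul_factorial_le` absorbs the
factorials, and the binomials sum by the hockey-stick identity. Positivity of `d` makes the factor
`d - 1` nonnegative. -/
theorem permSum_le {d : ℕ} (hd : 0 < d) (n : ℕ) :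
    permSum d n ≤ (n.factorial : ℝ) * (d * ((n + d).choose d : ℝ)) := by
  have hd1 : (1 : ℝ) ≤ d := by exact_mod_cast hd
  induction n using Nat.strong_induction_on with
  | _ n ih =>
    rcases n with _ | n
    · simp [permSum_zero]; exact_mod_cast hd
    rw [permSum_recurrence, Finset.sum_range_succ]
    simp only [Nat.add_sub_cancel, Nat.sub_self, permSum_zero, mul_one]
    have h1 : ∑ i ∈ Finset.range n, ((i + 1).factorial : ℝ) * permSum d (n - i) ≤
        ∑ i ∈ Finset.range n, (n.factorial : ℝ) * (d * ((n - i + d).choose d : ℝ)) := by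
      refine Finset.sum_le_sum fun i hi => ?_
      have hi := Finset.mem_range.mp hi
      have h2 := factorial_succ_mul_factorial_le (i := i) (m := n - i) (by omega)
      rw [show i + (n - i) = n by omega] at h2
      calc ((i + 1).factorial : ℝ) * permSum d (n - i)
          ≤ ((i + 1).factorial : ℝ) *
            (((n - i).factorial : ℝ) * (d * ((n - i + d).choose d : ℝ))) := by
            gcongr
            exact ih _ (by omega)
        _ = (((i + 1).factorial * (n - i).factorial : ℕ) : ℝ) *
            (d * ((n - i + d).choose d : ℝ)) := by push_cast; ring
        _ ≤ _ := by gcongr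
    rw [← Finset.mul_sum, ← Finset.mul_sum] at h1
    have h3 : (∑ i ∈ Finset.range n, ((n - i + d).choose d : ℝ)) + 1 =
        ((n + 1 + d).choose (d + 1) : ℝ) := by
      have e1 := Finset.sum_range_reflect (fun i => ((i + d).choose d : ℝ)) (n + 1)
      rw [Finset.sum_range_succ] at e1
      simp only [Nat.add_sub_cancel, Nat.sub_self, zero_add, Nat.choose_self, Nat.cast_one] at e1
      rw [e1]
      have := Nat.sum_range_add_choose n d
      rw [show n + 1 + d = n + d + 1 by ring, ← this]
      push_cast
      rfl
    have h4 : ((n + 1 + d).choose (d + 1) : ℝ) * (d + 1) =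
        ((n + 1 + d).choose d : ℝ) * (n + 1) := by
      have := Nat.choose_succ_right_eq (n + 1 + d) d
      rw [show n + 1 + d - d = n + 1 by omega] at this
      exact_mod_cast this
    have h5 : ((d : ℝ) + 1) ≤ ((n + 1 + d).choose d : ℝ) := by
      have : (d + 1).choose d ≤ (n + 1 + d).choose d := Nat.choose_le_choose d (by omega)
      rw [Nat.choose_succ_self_right] at this
      exact_mod_cast this
    rw [Nat.factorial_succ]
    push_cast
    set X := ((n + 1 + d).choose d : ℝ)
    set Y := ((n + 1 + d).choose (d + 1) : ℝ)
    set S := ∑ i ∈ Finset.range n, ((n - i + d).choose d : ℝ)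
    have hf : (0 : ℝ) < n.factorial := by positivity
    have hS : d * S ≤ d * Y := by nlinarith
    -- After multiplication by `d + 1` and use of `h4`, the difference of the two sides is `(n + 1)
    -- d (2X - (d + 1))`, nonnegative by `h5`.
    have h6 : (d : ℝ) * Y * (d - 1) ≤ (n + 1) * (X * d - d) := by
      have e : (d : ℝ) * Y * (d - 1) * (d + 1) = d * (d - 1) * (X * (n + 1)) := by
        rw [← h4]; ring
      have : (d : ℝ) * Y * (d - 1) * (d + 1) ≤ (n + 1) * (X * d - d) * (d + 1) := by
        rw [e]
        have : 0 ≤ ((n : ℝ) + 1) * d * (2 * X - (d + 1)) := by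
          apply mul_nonneg (by positivity); linarith
        nlinarith
      exact le_of_mul_le_mul_right this (by positivity)
    calc _ ≤ ((n : ℝ) + 1) * n.factorial + (d - 1) *
          (n.factorial * (d * Y) + (n + 1) * n.factorial) := by
          have : (n.factorial : ℝ) * (d * S) ≤ n.factorial * (d * Y) := by gcongr
          have := h1.trans this
          have hdd : (0 : ℝ) ≤ d - 1 := by linarith
          gcongr
      _ = n.factorial * ((d : ℝ) * Y * (d - 1) + (n + 1) * d) := by ring
      _ ≤ n.factorial * ((n + 1) * (X * d - d) + (n + 1) * d) := by gcongr
      _ = _ := by ring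

theorem permSum_zero_left {n : ℕ} (hn : 0 < n) : permSum 0 n = 0 := by
  have h := permPoly_eq_permSum 0 hn
  rw [Nat.cast_zero] at h
  rw [← h, permPoly]
  refine Finset.sum_eq_zero fun j hj => ?_
  have := (Finset.mem_Icc.mp hj).1
  simp [show j ≠ 0 by omega]

theorem summable_permSum (d : ℕ) {x : ℝ} (hx0 : 0 ≤ x) (hx1 : x < 1) :
    Summable fun n : ℕ => x ^ n / (n.factorial : ℝ) * permSum d n := by
  rcases Nat.eq_zero_or_pos d with rfl | hd
  · refine summable_of_ne_finset_zero (s := {0}) fun n hn => ?_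
    rw [Nat.cast_zero, permSum_zero_left (Nat.pos_of_ne_zero (by simpa using hn)), mul_zero]
  · have h := (summable_choose_mul_geometric_of_norm_lt_one d
      (r := x) (by rwa [Real.norm_of_nonneg hx0])).mul_left (d : ℝ)
    refine Summable.of_nonneg_of_le
      (fun n => mul_nonneg (by positivity) (permSum_nonneg (by positivity) n)) (fun n => ?_) h
    have hf : (0 : ℝ) < n.factorial := by positivity
    calc x ^ n / (n.factorial : ℝ) * permSum d n
        ≤ x ^ n / (n.factorial : ℝ) * ((n.factorial : ℝ) * (d * ((n + d).choose d : ℝ))) := by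
          gcongr
          exact permSum_le hd n
      _ = _ := by field_simp

theorem hasSum_ite_mem_finset {ι : Type*} [DecidableEq ι] (S : Finset ι) (f : ι → ℝ) :
    HasSum (fun i => if i ∈ S then f i else 0) (∑ i ∈ S, f i) := by
  have h := hasSum_sum_of_ne_finset_zero (L := SummationFilter.unconditional _)
    (f := fun i => if i ∈ S then f i else 0) (s := S) fun i hi => if_neg hi
  rwa [Finset.sum_congr rfl fun i hi => if_pos hi] at h

/-! ### Generator and semigroup on bounded functions. -/

section transition

variable {d : ℕ} {al lam mu : ℝ} {P : ℝ → StarState d → StarState d → ℝ}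

/-- The distance of a vertex of the star graph from the origin. -/
def starLevel : StarState d → ℕ
  | none => 0
  | some (_, k) => k

theorem finite_starLevel_le (n : ℕ) : {v : StarState d | starLevel v ≤ n}.Finite := by
  have h : {v : StarState d | starLevel v ≤ n} ⊆ {none} ∪
      some '' ((Set.univ : Set (Fin d)) ×ˢ ((PNat.val) ⁻¹' (Set.Iic n))) := by
    rintro (_ | ⟨j, k⟩) hv
    · simp
    · right
      exact ⟨(j, k), ⟨Set.mem_univ _, hv⟩, rfl⟩
  refine Set.Finite.subset ((Set.finite_singleton _).union (Set.Finite.image _ ?_)) h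
  exact Set.finite_univ.prod ((Set.finite_Iic n).preimage PNat.coe_injective.injOn)

theorem starRate_eq_zero {u v : StarState d} (h : starLevel u + 1 < starLevel v) :
    starRate d al lam mu u v = 0 := by
  rcases u with _ | ⟨i, k⟩ <;> rcases v with _ | ⟨j, l⟩ <;>
    simp only [starLevel, starRate] at h ⊢
  · rw [if_neg]
    rintro rfl
    simp at h
  · omega
  · have h1 : l ≠ k + 1 := by
      rintro rfl
      simp at h
    have h2 : k ≠ l + 1 := by
      rintro rfl
      rw [PNat.add_coe] at h
      omega
    simp [h1, h2]

theorem starRate_nonneg (hal : 0 ≤ al) (hlam : 0 ≤ lam) (hmu : 0 ≤ mu) (u v : StarState d) :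
    0 ≤ starRate d al lam mu u v := by
  rcases u with _ | ⟨i, k⟩ <;> rcases v with _ | ⟨j, l⟩ <;> simp only [starRate] <;>
    repeat' split_ifs
  all_goals positivity

theorem sum_starRate_eq (d : ℕ) (al lam mu : ℝ) (u : StarState d) (S : Finset (StarState d))
    (hS : ∀ w, w ∉ S → starLevel u + 1 < starLevel w) :
    ∑ w ∈ S, starRate d al lam mu u w = starExitRate d al lam mu u := by
  rw [← (hasSum_starRate d al lam mu u).tsum_eq]
  exact (tsum_eq_sum fun w hw => starRate_eq_zero (hS w hw)).symm

/-- The generator of the walk on the star graph. -/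
noncomputable def starGen (al lam mu : ℝ) (f : StarState d → ℝ) (u : StarState d) : ℝ :=
  ∑' w, starRate d al lam mu u w * (f w - f u)

theorem starGen_eq_sum (f : StarState d → ℝ) (u : StarState d) {S : Finset (StarState d)}
    (hS : ∀ w, w ∉ S → starLevel u + 1 < starLevel w) :
    starGen al lam mu f u = ∑ w ∈ S, starRate d al lam mu u w * (f w - f u) :=
  tsum_eq_sum fun w hw => by rw [starRate_eq_zero (hS w hw), zero_mul]

theorem starGen_none (φ : ℕ → ℝ) :
    starGen al lam mu (fun v : StarState d => φ (starLevel v)) none = d * al * (φ 1 - φ 0) := by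
  classical
  rw [starGen, tsum_eq_sum (s := Finset.univ.image (fun j : Fin d => (some (j, 1) : StarState d))),
    Finset.sum_image (by intro a _ b _ hab; simpa using hab)]
  · simp [starRate, starLevel, mul_assoc]
  · rintro (_ | ⟨j, l⟩) hv
    · simp
    · have hl : l ≠ 1 := by
        rintro rfl
        exact hv (Finset.mem_image_of_mem _ (Finset.mem_univ j))
      simp [starRate, hl]

theorem starGen_some (φ : ℕ → ℝ) (i : Fin d) (k : ℕ+) :
    starGen al lam mu (fun v : StarState d => φ (starLevel v)) (some (i, k)) =
      (al + lam * (k : ℝ)) * (φ (k + 1) - φ k) + mu * (k : ℝ) * (φ (k - 1) - φ k) := by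
  classical
  by_cases hk : k = 1
  · subst hk
    rw [starGen, tsum_eq_sum (s := {none, some (i, 1 + 1)}), Finset.sum_pair (by simp)]
    · simp [starRate, starLevel]
      ring
    · rintro (_ | ⟨j, l⟩) hv
      · simp at hv
      · by_cases hij : i = j
        · subst hij
          have h1 : l ≠ 1 + 1 := by rintro rfl; simp at hv
          have h2 : (1 : ℕ+) ≠ l + 1 := by
            intro h; have := congrArg PNat.val h; have := l.pos; simp at *
          simp only [starRate, h1, h2, if_true, if_false, zero_mul]
        · simp [starRate, hij]
  · obtain ⟨m, rfl⟩ : ∃ m : ℕ+, k = m + 1 := PNat.exists_eq_succ_of_ne_one hk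
    have hne : m ≠ m + 1 + 1 := by
      intro h; have := congrArg PNat.val h; simp at this; omega
    rw [starGen, tsum_eq_sum (s := {some (i, m), some (i, m + 1 + 1)}),
      Finset.sum_pair (by simpa using hne)]
    · simp only [starRate, if_true, if_neg hne, starLevel, PNat.add_coe, PNat.one_coe,
        Nat.add_sub_cancel]
      ring
    · rintro (_ | ⟨j, l⟩) hv
      · simp [starRate, hk]
      · by_cases hij : i = j
        · subst hij
          have h1 : l ≠ m + 1 + 1 := by rintro rfl; simp at hv
          have h2 : m + 1 ≠ l + 1 := by
            intro h; apply hv; simp [add_right_cancel h]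
          simp only [starRate, h1, h2, if_true, if_false, zero_mul]
        · simp [starRate, hij]

/-- The expectation of `f` after time `h`, started at `u`. -/
noncomputable def starExpect (P : ℝ → StarState d → StarState d → ℝ) (h : ℝ)
    (f : StarState d → ℝ) (u : StarState d) : ℝ :=
  ∑' v, P h u v * f v

namespace IsStarTransition

theorem summable_mul (hP : IsStarTransition d al lam mu P) {h : ℝ} (hh : 0 ≤ h)
    {f : StarState d → ℝ} {B : ℝ} (hf : ∀ v, |f v| ≤ B) (u : StarState d) :
    Summable fun v => P h u v * f v := by
  refine Summable.of_norm_bounded ((hP.hasSum_one h hh u).summable.mul_right B) fun v => ?_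
  rw [norm_mul, Real.norm_of_nonneg (hP.nonneg h hh u v)]
  exact mul_le_mul_of_nonneg_left (hf v) (hP.nonneg h hh u v)

theorem abs_expect_le (hP : IsStarTransition d al lam mu P) {h : ℝ} (hh : 0 ≤ h)
    {f : StarState d → ℝ} {B : ℝ} (hf : ∀ v, |f v| ≤ B) (u : StarState d) :
    |starExpect P h f u| ≤ B := by
  have h1 := (hP.hasSum_one h hh u).mul_right B
  rw [one_mul] at h1
  rw [starExpect, ← Real.norm_eq_abs]
  refine tsum_of_norm_bounded h1 fun v => ?_
  rw [norm_mul, Real.norm_of_nonneg (hP.nonneg h hh u v)]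
  exact mul_le_mul_of_nonneg_left (hf v) (hP.nonneg h hh u v)

theorem expect_zero (hP : IsStarTransition d al lam mu P) (f : StarState d → ℝ)
    (u : StarState d) : starExpect P 0 f u = f u := by
  classical
  simp only [starExpect, hP.zero, ite_mul, one_mul, zero_mul]
  rw [tsum_eq_single u (fun v hv => if_neg (Ne.symm hv)), if_pos rfl]

theorem expect_add (hP : IsStarTransition d al lam mu P) {s t : ℝ} (hs : 0 ≤ s) (ht : 0 ≤ t)
    {f : StarState d → ℝ} {B : ℝ} (hf : ∀ v, |f v| ≤ B) (u : StarState d) :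
    starExpect P (s + t) f u = starExpect P s (starExpect P t f) u := by
  have hB : 0 ≤ B := (abs_nonneg _).trans (hf u)
  have hG : Summable fun p : StarState d × StarState d => P s u p.1 * (P t p.1 p.2 * B) := by
    refine (summable_prod_of_nonneg fun p => mul_nonneg (hP.nonneg s hs _ _)
      (mul_nonneg (hP.nonneg t ht _ _) hB)).mpr ⟨fun w => ?_, ?_⟩
    · exact ((hP.hasSum_one t ht w).summable.mul_right B).mul_left (P s u w)
    · simp only [tsum_mul_left, tsum_mul_right, (hP.hasSum_one t ht _).tsum_eq]
      exact (hP.hasSum_one s hs u).summable.mul_right _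
  have hF : Summable (Function.uncurry fun w v : StarState d => P s u w * (P t w v * f v)) := by
    refine Summable.of_norm_bounded hG fun p => ?_
    rw [Function.uncurry, norm_mul, norm_mul, Real.norm_of_nonneg (hP.nonneg s hs _ _),
      Real.norm_of_nonneg (hP.nonneg t ht _ _)]
    exact mul_le_mul_of_nonneg_left (mul_le_mul_of_nonneg_left (hf _) (hP.nonneg t ht _ _))
      (hP.nonneg s hs _ _)
  have h1 := hF.tsum_comm
  simp only [starExpect]
  calc ∑' v, P (s + t) u v * f v = ∑' v, ∑' w, P s u w * (P t w v * f v) := by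
        refine tsum_congr fun v => ?_
        rw [← (hP.chapman_kolmogorov s t hs ht u v).tsum_eq, ← tsum_mul_right]
        exact tsum_congr fun w => by ring
    _ = ∑' w, ∑' v, P s u w * (P t w v * f v) := h1
    _ = _ := tsum_congr fun w => tsum_mul_left

theorem hasSum_expect_sub (hP : IsStarTransition d al lam mu P) {h : ℝ} (hh : 0 ≤ h)
    {f : StarState d → ℝ} {B : ℝ} (hf : ∀ v, |f v| ≤ B) (u : StarState d) :
    HasSum (fun w => P h u w * (f w - f u)) (starExpect P h f u - f u) := by
  have h1 := (hP.summable_mul hh hf u).hasSum.sub ((hP.hasSum_one h hh u).mul_right (f u))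
  rw [one_mul] at h1
  simp only [mul_sub]
  exact h1

/-- Stochasticity controls the tail: the mass outside `S` is `1` minus the mass inside, and each
increment of `f` is at most `2B`. -/
theorem abs_expect_sub_sum_le (hP : IsStarTransition d al lam mu P) {h : ℝ} (hh : 0 ≤ h)
    {f : StarState d → ℝ} {B : ℝ} (hf : ∀ v, |f v| ≤ B) (u : StarState d)
    (S : Finset (StarState d)) :
    |starExpect P h f u - f u - ∑ w ∈ S, P h u w * (f w - f u)| ≤
      (1 - ∑ w ∈ S, P h u w) * (2 * B) := by
  classical
  have h1 := (hP.hasSum_expect_sub hh hf u).sub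
    (hasSum_ite_mem_finset S fun w => P h u w * (f w - f u))
  have h2 := ((hP.hasSum_one h hh u).sub
    (hasSum_ite_mem_finset S fun w => P h u w)).mul_right (2 * B)
  rw [← h1.tsum_eq, ← Real.norm_eq_abs]
  refine tsum_of_norm_bounded h2 fun w => ?_
  by_cases hw : w ∈ S
  · simp [hw]
  · simp only [if_neg hw, sub_zero]
    rw [norm_mul, Real.norm_of_nonneg (hP.nonneg h hh u w)]
    refine mul_le_mul_of_nonneg_left ?_ (hP.nonneg h hh u w)
    calc |f w - f u| ≤ |f w| + |f u| := abs_sub _ _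
      _ ≤ 2 * B := by linarith [hf w, hf u]

theorem mul_le_apply_add (hP : IsStarTransition d al lam mu P) {s t : ℝ} (hs : 0 ≤ s)
    (ht : 0 ≤ t) (u : StarState d) : P s u u * P t u u ≤ P (s + t) u u :=
  le_hasSum (hP.chapman_kolmogorov s t hs ht u u) u fun _ _ =>
    mul_nonneg (hP.nonneg s hs _ _) (hP.nonneg t ht _ _)

theorem pow_le_apply_mul (hP : IsStarTransition d al lam mu P) {h : ℝ} (hh : 0 ≤ h)
    (u : StarState d) (n : ℕ) : P h u u ^ n ≤ P (n * h) u u := by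
  induction n with
  | zero => simp [hP.zero]
  | succ n ih =>
    rw [pow_succ, Nat.cast_succ, add_mul, one_mul]
    exact (mul_le_mul_of_nonneg_right ih (hP.nonneg h hh u u)).trans
      (hP.mul_le_apply_add (by positivity) hh u)

/-- Staying put over each of `n` short steps forces return at the end, so `P (h/n) u u ^ n ≤ P h u
u`. With Bernoulli's inequality, `1 - P h u u ≤ n (1 - P (h/n) u u)`, and the right side tends to
the exit rate times `h`. An infinitesimal rate thus becomes a bound for every `h`, as domination
will require. -/
theorem one_sub_apply_le (hP : IsStarTransition d al lam mu P) {h : ℝ} (hh : 0 ≤ h)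
    (u : StarState d) : 1 - P h u u ≤ starExitRate d al lam mu u * h := by
  rcases hh.eq_or_lt with rfl | hpos
  · simp [hP.zero]
  have h1 : Tendsto (fun n : ℕ => h / ((n : ℝ) + 1)) atTop (𝓝[>] 0) := by
    refine tendsto_nhdsWithin_iff.mpr ⟨?_, Eventually.of_forall fun n => ?_⟩
    · have := tendsto_one_div_add_atTop_nhds_zero_nat (𝕜 := ℝ)
      have := this.const_mul h
      simpa [div_eq_mul_inv] using this
    · exact Set.mem_Ioi.mpr (by positivity)
  have h2 := ((hP.exit_rate u).comp h1).mul_const h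
  refine ge_of_tendsto' h2 fun n => ?_
  have hn : 0 ≤ h / ((n : ℝ) + 1) := by positivity
  have h3 := hP.pow_le_apply_mul hn u (n + 1)
  have h4 := one_add_mul_le_pow (a := P (h / ((n : ℝ) + 1)) u u - 1)
    (by linarith [hP.nonneg _ hn u u]) (n + 1)
  rw [add_sub_cancel] at h4
  have h5 : ((n + 1 : ℕ) : ℝ) * (h / ((n : ℝ) + 1)) = h := by
    push_cast
    field_simp
  rw [h5] at h3
  push_cast at h4
  have h6 : (1 - P (h / ((n : ℝ) + 1)) u u) / (h / ((n : ℝ) + 1)) * h =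
      (n + 1) * (1 - P (h / ((n : ℝ) + 1)) u u) := by
    field_simp
  simp only [Function.comp_apply]
  rw [h6]
  linarith

theorem abs_expect_sub_le (hP : IsStarTransition d al lam mu P) {h : ℝ} (hh : 0 ≤ h)
    {f : StarState d → ℝ} {B : ℝ} (hf : ∀ v, |f v| ≤ B) (u : StarState d) :
    |starExpect P h f u - f u| ≤ starExitRate d al lam mu u * h * (2 * B) := by
  have hB : 0 ≤ B := (abs_nonneg _).trans (hf u)
  have h1 := hP.abs_expect_sub_sum_le hh hf u {u}
  rw [Finset.sum_singleton, Finset.sum_singleton, sub_self, mul_zero, sub_zero] at h1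
  exact h1.trans (mul_le_mul_of_nonneg_right (hP.one_sub_apply_le hh u) (by positivity))

theorem abs_expect_add_sub_le (hP : IsStarTransition d al lam mu P) {t h : ℝ} (ht : 0 ≤ t)
    (hh : 0 ≤ h) {f : StarState d → ℝ} {B : ℝ} (hf : ∀ v, |f v| ≤ B) (u : StarState d) :
    |starExpect P (t + h) f u - starExpect P t f u| ≤
      starExitRate d al lam mu u * h * (2 * B) := by
  rw [add_comm t h, hP.expect_add hh ht hf]
  exact hP.abs_expect_sub_le hh (hP.abs_expect_le ht hf) u

theorem abs_expect_sub_expect_le (hP : IsStarTransition d al lam mu P) {s t : ℝ} (hs : 0 ≤ s)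
    (ht : 0 ≤ t) {f : StarState d → ℝ} {B : ℝ} (hf : ∀ v, |f v| ≤ B) (u : StarState d) :
    |starExpect P s f u - starExpect P t f u| ≤
      starExitRate d al lam mu u * |s - t| * (2 * B) := by
  rcases le_total s t with h | h
  · have := hP.abs_expect_add_sub_le hs (sub_nonneg.mpr h) hf u
    rw [add_sub_cancel] at this
    rwa [abs_sub_comm, abs_sub_comm s t, abs_of_nonneg (sub_nonneg.mpr h)]
  · have := hP.abs_expect_add_sub_le ht (sub_nonneg.mpr h) hf u
    rw [add_sub_cancel] at this
    rwa [abs_of_nonneg (sub_nonneg.mpr h)]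

theorem continuousOn_expect (hP : IsStarTransition d al lam mu P)
    {f : StarState d → ℝ} {B : ℝ} (hf : ∀ v, |f v| ≤ B) (u : StarState d) :
    ContinuousOn (fun t => starExpect P t f u) (Set.Ici 0) := by
  intro t ht
  rw [ContinuousWithinAt, tendsto_iff_dist_tendsto_zero]
  have h1 : Tendsto (fun s => starExitRate d al lam mu u * |s - t| * (2 * B))
      (𝓝[Set.Ici 0] t) (𝓝 (starExitRate d al lam mu u * |t - t| * (2 * B))) := by
    apply Continuous.continuousWithinAt
    fun_prop
  rw [sub_self, abs_zero, mul_zero, zero_mul] at h1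
  refine squeeze_zero' (Eventually.of_forall fun _ => dist_nonneg) ?_ h1
  filter_upwards [self_mem_nhdsWithin] with s hs
  exact hP.abs_expect_sub_expect_le hs ht hf u

/-- The rates into the finite ball `S` already exhaust the exit rate, so the mass leaving `S` is
`o(h)` and only finitely many limits are taken. The function may vary with `h`, because it will be
an expectation or a generating function for a remaining time `s - h`. -/
theorem tendsto_expect_sub_div (hP : IsStarTransition d al lam mu P)
    {g : ℝ → StarState d → ℝ} {f : StarState d → ℝ} {B : ℝ}
    (hg : ∀ᶠ h in 𝓝[>] 0, ∀ v, |g h v| ≤ B)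
    (hlim : ∀ v, Tendsto (fun h => g h v) (𝓝[>] 0) (𝓝 (f v))) (u : StarState d) :
    Tendsto (fun h => (starExpect P h (g h) u - g h u) / h) (𝓝[>] 0)
      (𝓝 (starGen al lam mu f u)) := by
  classical
  set S := (finite_starLevel_le (d := d) (starLevel u + 1)).toFinset with hSdef
  have hS : ∀ w, w ∉ S → starLevel u + 1 < starLevel w := fun w hw => by
    simpa [hSdef] using hw
  have huS : u ∈ S := by simp [hSdef]
  have h1 : Tendsto (fun h => ∑ w ∈ S, P h u w / h * (g h w - g h u)) (𝓝[>] 0)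
      (𝓝 (∑ w ∈ S, starRate d al lam mu u w * (f w - f u))) := by
    refine tendsto_finsetSum _ fun w _ => ?_
    rcases eq_or_ne u w with rfl | hne
    · simp
    · exact (hP.rate u w hne).mul ((hlim w).sub (hlim u))
  have hrate : ∑ w ∈ S.erase u, starRate d al lam mu u w = starExitRate d al lam mu u := by
    have h2 := (sum_starRate_eq d al lam mu u S hS)
    rw [← h2, ← Finset.add_sum_erase S _ huS]
    have : starRate d al lam mu u u = 0 := by
      rcases u with _ | ⟨i, k⟩
      · rfl
      · have : k ≠ k + 1 := by
          intro h; have := congrArg PNat.val h; simp at this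
        simp [starRate, this]
    rw [this, zero_add]
  have h3 : Tendsto (fun h => ((1 - P h u u) / h - ∑ w ∈ S.erase u, P h u w / h) * (2 * B))
      (𝓝[>] 0) (𝓝 0) := by
    have := ((hP.exit_rate u).sub (tendsto_finsetSum (S.erase u) fun w hw =>
      hP.rate u w (Finset.ne_of_mem_erase hw).symm)).mul_const (2 * B)
    rwa [hrate, sub_self, zero_mul] at this
  have h4 : Tendsto (fun h => (starExpect P h (g h) u - g h u) / h -
      ∑ w ∈ S, P h u w / h * (g h w - g h u)) (𝓝[>] 0) (𝓝 0) := by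
    refine squeeze_zero_norm' ?_ h3
    filter_upwards [hg, self_mem_nhdsWithin] with h hh hpos
    have hpos : 0 < h := hpos
    have h5 := hP.abs_expect_sub_sum_le hpos.le hh u S
    rw [← Finset.add_sum_erase S (fun w => P h u w) huS] at h5
    have e1 : (starExpect P h (g h) u - g h u) / h - ∑ w ∈ S, P h u w / h * (g h w - g h u) =
        (starExpect P h (g h) u - g h u - ∑ w ∈ S, P h u w * (g h w - g h u)) / h := by
      rw [sub_div (starExpect P h (g h) u - g h u) _ h, Finset.sum_div]
      congr 1
      exact Finset.sum_congr rfl fun w _ => by ring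
    have e2 : ((1 - P h u u) / h - ∑ w ∈ S.erase u, P h u w / h) * (2 * B) =
        (1 - (P h u u + ∑ w ∈ S.erase u, P h u w)) * (2 * B) / h := by
      rw [← Finset.sum_div]
      ring
    rw [e1, e2, norm_div, Real.norm_of_nonneg hpos.le]
    exact div_le_div_of_nonneg_right h5 hpos.le
  rw [starGen_eq_sum f u hS]
  simpa using h4.add h1

end IsStarTransition

end transition

/-! ### First moment of the distance from the origin. -/

section moment

variable {d : ℕ} {al lam mu : ℝ} {P : ℝ → StarState d → StarState d → ℝ}

theorem starGen_mono (hal : 0 ≤ al) (hlam : 0 ≤ lam) (hmu : 0 ≤ mu) {f g : StarState d → ℝ}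
    {u : StarState d} (h : ∀ w, f w - f u ≤ g w - g u) :
    starGen al lam mu f u ≤ starGen al lam mu g u := by
  have hS : ∀ w, w ∉ (finite_starLevel_le (d := d) (starLevel u + 1)).toFinset →
      starLevel u + 1 < starLevel w := fun w hw => by simpa using hw
  rw [starGen_eq_sum f u hS, starGen_eq_sum g u hS]
  exact Finset.sum_le_sum fun w _ =>
    mul_le_mul_of_nonneg_left (h w) (starRate_nonneg hal hlam hmu u w)

theorem tendsto_sub_nhdsGT_zero (t : ℝ) :
    Tendsto (fun h : ℝ => t - h) (𝓝[>] 0) (𝓝 t) := by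
  have : Tendsto (fun h : ℝ => t - h) (𝓝 0) (𝓝 (t - 0)) := by
    apply Continuous.tendsto
    fun_prop
  rw [sub_zero] at this
  exact this.mono_left nhdsWithin_le_nhds

namespace IsStarTransition

/-- A maximum principle for the backward equation, with barrier `level + 1 + Ct`. It is stated for
bounded `f` below `level + 1`, so that only the bounded semigroup enters and no integrability of the
level is presupposed. -/
theorem expect_le_of_le_level (hP : IsStarTransition d al lam mu P) (hal : 0 ≤ al)
    (hlam : 0 ≤ lam) (hmu : 0 ≤ mu) {C : ℝ} (hC0 : 0 ≤ C)
    (hC : ∀ u : StarState d, starGen al lam mu (fun v => (starLevel v : ℝ) + 1) u ≤ C)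
    {f : StarState d → ℝ} {B : ℝ} (hf : ∀ v, |f v| ≤ B) (hfV : ∀ v, f v ≤ starLevel v + 1)
    {t : ℝ} (ht : 0 ≤ t) (u : StarState d) :
    starExpect P t f u ≤ starLevel u + 1 + C * t := by
  have key : ∀ ε : ℝ, 0 < ε → ∀ T : ℝ, 0 ≤ T → ∀ v : StarState d,
      starExpect P T f v ≤ starLevel v + 1 + (C + ε) * T + ε := by
    intro ε hε T hT v
    by_contra! hcon
    -- The gap below the barrier. The additive `ε` makes it positive at time `0`; the `ε` in the
    -- slope makes the final contradiction strict.
    set D : StarState d → ℝ → ℝ := fun w s =>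
      starLevel w + 1 + (C + ε) * s + ε - starExpect P s f w with hD
    have hDc : ∀ w, ContinuousOn (D w) (Set.Ici 0) := fun w =>
      ContinuousOn.sub (by fun_prop) (hP.continuousOn_expect hf w)
    obtain ⟨N, hN⟩ := exists_nat_ge B
    set K := {w : StarState d | starLevel w ≤ N}
    -- Far from the origin the level alone exceeds the bound `B`, so the gap can close only on the
    -- finite set `K`. This is what makes a first closing time exist.
    have hout : ∀ w, w ∉ K → ∀ s, 0 ≤ s → 0 < D w s := by
      intro w hw s hs
      have h1 : N < starLevel w := by simpa [K] using hw
      have h2 : (N : ℝ) < starLevel w := by exact_mod_cast h1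
      have h3 := (abs_le.mp (hP.abs_expect_le hs hf w)).2
      have h4 : 0 ≤ (C + ε) * s := by positivity
      simp only [hD]
      linarith
    set Z := ⋃ w ∈ K, (Set.Icc 0 T ∩ D w ⁻¹' Set.Iic 0) with hZ
    have hZclosed : IsClosed Z := (finite_starLevel_le N).isClosed_biUnion fun w _ =>
      ((hDc w).mono Set.Icc_subset_Ici_self).preimage_isClosed_of_isClosed isClosed_Icc isClosed_Iic
    have hZsub : Z ⊆ Set.Icc 0 T := Set.iUnion₂_subset fun w _ => Set.inter_subset_left
    have hDv : D v T < 0 := by simp only [hD]; linarith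
    have hZne : Z.Nonempty := by
      refine ⟨T, Set.mem_iUnion₂.mpr ⟨v, ?_, ⟨hT, le_rfl⟩, hDv.le⟩⟩
      by_contra hv
      exact absurd (hout v hv T hT) hDv.not_gt
    obtain ⟨s, hsZ, hsmin⟩ := (isCompact_Icc.of_isClosed_subset hZclosed hZsub).exists_isLeast hZne
    obtain ⟨w, hwK, ⟨hs0, hsT⟩, hws⟩ := Set.mem_iUnion₂.mp hsZ
    have hws : D w s ≤ 0 := hws
    have hpos : ∀ r, 0 ≤ r → r < s → ∀ x, 0 < D x r := by
      intro r hr0 hrs x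
      by_cases hx : x ∈ K
      · by_contra! hxr
        exact absurd (hsmin (Set.mem_iUnion₂.mpr ⟨x, hx, ⟨hr0, hrs.le.trans hsT⟩, hxr⟩)) hrs.not_ge
      · exact hout x hx r hr0
    have hs : 0 < s := by
      rcases hs0.eq_or_lt with rfl | h
      · simp only [hD, hP.expect_zero] at hws
        have := hfV w
        linarith
      · exact h
    have hsmall : ∀ᶠ h in 𝓝[>] (0 : ℝ), 0 < h ∧ h < s := by
      filter_upwards [Ioo_mem_nhdsGT hs] with h hh using hh
    have hlimM : ∀ x, Tendsto (fun h => starExpect P (s - h) f x) (𝓝[>] 0)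
        (𝓝 (starExpect P s f x)) := by
      intro x
      refine (hP.continuousOn_expect hf x s hs0).tendsto.comp (tendsto_nhdsWithin_iff.mpr
        ⟨tendsto_sub_nhdsGT_zero s, ?_⟩)
      filter_upwards [hsmall] with h hh
      exact Set.mem_Ici.mpr (by linarith [hh.2])
    have hDnonneg : ∀ x, 0 ≤ D x s := by
      intro x
      have h1 : Tendsto (fun h => D x (s - h)) (𝓝[>] 0) (𝓝 (D x s)) := by
        simp only [hD]
        exact ((((tendsto_sub_nhdsGT_zero s).const_mul _).const_add _).add_const _).sub (hlimM x)
      refine ge_of_tendsto h1 ?_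
      filter_upwards [hsmall] with h hh
      exact (hpos _ (by linarith [hh.2]) (by linarith [hh.1]) x).le
    have hlim := hP.tendsto_expect_sub_div (g := fun h x => starExpect P (s - h) f x)
      (f := fun x => starExpect P s f x) (B := B) (by
        filter_upwards [hsmall] with h hh x
        exact hP.abs_expect_le (by linarith [hh.2]) hf x) hlimM w
    -- The gap at `w` was positive before `s` and is not positive at `s`, so the expectation has
    -- backward difference quotients above `C + ε`. By the semigroup property these quotients tend
    -- to the generator.
    have h1 : C + ε ≤ starGen al lam mu (fun x => starExpect P s f x) w := by
      refine ge_of_tendsto hlim ?_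
      filter_upwards [hsmall] with h hh
      have h2 := hP.expect_add hh.1.le (t := s - h) (by linarith [hh.2]) hf w
      rw [add_sub_cancel] at h2
      rw [← h2, le_div_iff₀ hh.1]
      have h3 := hpos (s - h) (by linarith [hh.2]) (by linarith [hh.1]) w
      simp only [hD] at h3 hws
      linarith
    -- At time `s` the gap is nonnegative everywhere and at most `0` at `w`, so increments of the
    -- expectation from `w` are at most those of `level + 1`.
    have h2 : starGen al lam mu (fun x => starExpect P s f x) w ≤
        starGen al lam mu (fun v => (starLevel v : ℝ) + 1) w := by
      refine starGen_mono hal hlam hmu fun x => ?_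
      have h3 := hDnonneg x
      simp only [hD] at h3 hws
      linarith
    linarith [hC w]
  refine le_of_forall_pos_le_add fun ε hε => ?_
  have ht1 : 0 < t + 1 := by linarith
  have h1 := key (ε / (t + 1)) (by positivity) t ht u
  have h2 : (C + ε / (t + 1)) * t + ε / (t + 1) = C * t + ε := by
    field_simp
    ring
  linarith

/-- Apply the maximum principle to `level + 1` cut off outside a finite set: the partial sums are
bounded uniformly. -/
theorem summable_level (hP : IsStarTransition d al lam mu P) (hal : 0 ≤ al)
    (hlam : 0 ≤ lam) (hmu : 0 ≤ mu) {C : ℝ} (hC0 : 0 ≤ C)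
    (hC : ∀ u : StarState d, starGen al lam mu (fun v => (starLevel v : ℝ) + 1) u ≤ C)
    {t : ℝ} (ht : 0 ≤ t) (u : StarState d) :
    Summable (fun v => P t u v * ((starLevel v : ℝ) + 1)) ∧
      ∑' v, P t u v * ((starLevel v : ℝ) + 1) ≤ starLevel u + 1 + C * t := by
  classical
  have h0 : ∀ v, 0 ≤ P t u v * ((starLevel v : ℝ) + 1) := fun v =>
    mul_nonneg (hP.nonneg t ht u v) (by positivity)
  have h1 : ∀ s : Finset (StarState d),
      ∑ v ∈ s, P t u v * ((starLevel v : ℝ) + 1) ≤ starLevel u + 1 + C * t := by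
    intro s
    have h2 := hP.expect_le_of_le_level hal hlam hmu hC0 hC
      (f := fun v => if v ∈ s then (starLevel v : ℝ) + 1 else 0)
      (B := ∑ v ∈ s, ((starLevel v : ℝ) + 1)) (fun v => ?_) (fun v => ?_) ht u
    · have h3 : starExpect P t (fun v => if v ∈ s then (starLevel v : ℝ) + 1 else 0) u =
          ∑ v ∈ s, P t u v * ((starLevel v : ℝ) + 1) := by
        rw [← (hasSum_ite_mem_finset s _).tsum_eq]
        simp [starExpect]
      rwa [h3] at h2
    · have h3 : ∀ x ∈ s, (0 : ℝ) ≤ starLevel x + 1 := fun x _ => by positivity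
      split_ifs with hv
      · rw [abs_of_nonneg (h3 v hv)]
        exact Finset.single_le_sum h3 hv
      · rw [abs_zero]
        exact Finset.sum_nonneg h3
    · split_ifs
      · exact le_rfl
      · positivity
  exact ⟨summable_of_sum_le h0 h1, Real.tsum_le_of_sum_le h0 h1⟩

end IsStarTransition

end moment

/-! ### The one-ray generating function and its defect at the origin. -/

section kernel

/-- The generating function at `1 - w` of the critical birth and death process with immigration,
at time `τ` and started from `k`. -/
noncomputable def critGen (lam w τ : ℝ) (k : ℕ) : ℝ :=
  (1 - w / (1 + lam * w * τ)) ^ k / (1 + lam * w * τ)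

/-- The derivative of `critGen` with respect to the time. -/
noncomputable def critGenDeriv (lam w τ : ℝ) (k : ℕ) : ℝ :=
  lam * (k * (1 - w / (1 + lam * w * τ)) ^ (k - 1) * (w / (1 + lam * w * τ)) ^ 2 -
    (1 - w / (1 + lam * w * τ)) ^ k * (w / (1 + lam * w * τ))) / (1 + lam * w * τ)

variable {lam w τ : ℝ}

theorem one_le_critDenom (hlam : 0 ≤ lam) (hw : 0 ≤ w) (hτ : 0 ≤ τ) : 1 ≤ 1 + lam * w * τ := by
  have : 0 ≤ lam * w * τ := by positivity
  linarith

/-- The range `0 ≤ w ≤ 2` corresponds to `z = 1 - w` in `[-1, 1]`. Negative `z` is kept because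
power series in `z` are later compared around `0`. -/
theorem abs_critBase_le (hlam : 0 ≤ lam) (hw : 0 ≤ w) (hw2 : w ≤ 2) (hτ : 0 ≤ τ) :
    |1 - w / (1 + lam * w * τ)| ≤ 1 := by
  have h1 := one_le_critDenom hlam hw hτ
  have h2 : w / (1 + lam * w * τ) ≤ 2 := (div_le_self hw h1).trans hw2
  have h3 : 0 ≤ w / (1 + lam * w * τ) := by positivity
  rw [abs_le]
  constructor <;> linarith

theorem abs_critGen_le (hlam : 0 ≤ lam) (hw : 0 ≤ w) (hw2 : w ≤ 2) (hτ : 0 ≤ τ) (k : ℕ) :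
    |critGen lam w τ k| ≤ 1 := by
  have h1 := one_le_critDenom hlam hw hτ
  rw [critGen, abs_div, abs_pow, abs_of_nonneg (by linarith : 0 ≤ 1 + lam * w * τ)]
  exact (div_le_one (by linarith)).mpr
    ((pow_le_one₀ (abs_nonneg _) (abs_critBase_le hlam hw hw2 hτ)).trans h1)

theorem hasDerivAt_critGen (hlam : 0 ≤ lam) (hw : 0 ≤ w) (hτ : 0 ≤ τ) (k : ℕ) :
    HasDerivAt (fun τ => critGen lam w τ k) (critGenDeriv lam w τ k) τ := by
  have h1 := one_le_critDenom hlam hw hτ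
  have h0 : 1 + lam * w * τ ≠ 0 := by linarith
  have h2 : HasDerivAt (fun τ => 1 + lam * w * τ) (lam * w) τ := by
    simpa using ((hasDerivAt_id τ).const_mul (lam * w)).const_add 1
  have h3 := ((((hasDerivAt_const τ w).div h2 h0).const_sub 1).pow k).div h2 h0
  refine h3.congr_deriv ?_
  simp only [critGenDeriv, Pi.pow_apply, Pi.div_apply]
  field_simp
  ring

theorem abs_critGenDeriv_le (hlam : 0 ≤ lam) (hw : 0 ≤ w) (hw2 : w ≤ 2) (hτ : 0 ≤ τ) (k : ℕ) :
    |critGenDeriv lam w τ k| ≤ 4 * lam * (k + 1) := by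
  have h1 := one_le_critDenom hlam hw hτ
  have h2 : w / (1 + lam * w * τ) ≤ 2 := (div_le_self hw h1).trans hw2
  have h3 : 0 ≤ w / (1 + lam * w * τ) := by positivity
  have h4 := abs_critBase_le hlam hw hw2 hτ
  have h5 := pow_le_one₀ (n := k - 1) (abs_nonneg _) h4
  have h6 := pow_le_one₀ (n := k) (abs_nonneg _) h4
  rw [← abs_pow] at h5 h6
  rw [critGenDeriv]
  set δ := w / (1 + lam * w * τ)
  rw [abs_div, abs_of_nonneg (by linarith : 0 ≤ 1 + lam * w * τ)]
  refine (div_le_self (abs_nonneg _) h1).trans ?_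
  rw [abs_mul, abs_of_nonneg hlam]
  have h7 : |(k : ℝ) * (1 - δ) ^ (k - 1) * δ ^ 2 - (1 - δ) ^ k * δ| ≤ 4 * ((k : ℝ) + 1) := by
    refine (abs_sub _ _).trans ?_
    rw [abs_mul, abs_mul, abs_mul, abs_of_nonneg h3, abs_of_nonneg (sq_nonneg δ), Nat.abs_cast]
    have h8 : (k : ℝ) * |(1 - δ) ^ (k - 1)| * δ ^ 2 ≤ k * 1 * 2 ^ 2 := by gcongr
    have h9 : |(1 - δ) ^ k| * δ ≤ 1 * 2 := by gcongr
    linarith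
  calc lam * _ ≤ lam * (4 * ((k : ℝ) + 1)) := by gcongr
    _ = _ := by ring

theorem abs_critGen_sub_le (hlam : 0 ≤ lam) (hw : 0 ≤ w) (hw2 : w ≤ 2) {τ τ' : ℝ} (hτ : 0 ≤ τ)
    (hτ' : 0 ≤ τ') (k : ℕ) :
    |critGen lam w τ k - critGen lam w τ' k| ≤ 4 * lam * (k + 1) * |τ - τ'| :=
  (convex_Ici (0 : ℝ)).norm_image_sub_le_of_norm_hasDerivWithin_le
    (fun _ hx => (hasDerivAt_critGen hlam hw hx k).hasDerivWithinAt)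
    (fun _ hx => abs_critGenDeriv_le hlam hw hw2 hx k) hτ' hτ

/-- With exit rate `lam` from the origin the left side would vanish. The remaining rate `(d - 1) *
lam` multiplies the increment of `critGen` from `0` to `1`, which is `-w / (1 + lam * w * τ) ^ 2`.
-/
theorem starGen_critGen_none (d : ℕ) (mu : ℝ) (lam w τ : ℝ) :
    starGen lam lam mu (fun v : StarState d => critGen lam w τ (starLevel v)) none -
      critGenDeriv lam w τ 0 = -((d - 1) * lam * w / (1 + lam * w * τ) ^ 2) := by
  rw [starGen_none (critGen lam w τ)]
  simp only [critGen, critGenDeriv, pow_one, pow_zero, Nat.cast_zero]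
  by_cases h : 1 + lam * w * τ = 0
  · simp [h]
  · field_simp
    ring

theorem starGen_critGen_some {d : ℕ} (lam w τ : ℝ) (i : Fin d) (k : ℕ+) :
    starGen lam lam lam (fun v : StarState d => critGen lam w τ (starLevel v)) (some (i, k)) =
      critGenDeriv lam w τ k := by
  rw [starGen_some (critGen lam w τ)]
  obtain ⟨m, hm⟩ : ∃ m : ℕ, (k : ℕ) = m + 1 := ⟨k - 1, by have := k.pos; omega⟩
  simp only [critGen, critGenDeriv, hm, Nat.add_sub_cancel]
  push_cast
  ring

end kernel

/-! ### Duhamel's formula. -/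

namespace IsStarTransition

variable {d : ℕ} {lam : ℝ} {P : ℝ → StarState d → StarState d → ℝ}

/-- Birth and death cancel in the critical case: the drift is `lam` on a ray and `d * lam` at the
origin. -/
theorem starGen_level_le (hlam : 0 ≤ lam) (u : StarState d) :
    starGen lam lam lam (fun v => (starLevel v : ℝ) + 1) u ≤ (d + 1) * lam := by
  rcases u with _ | ⟨i, k⟩
  · rw [starGen_none (fun n => (n : ℝ) + 1)]
    push_cast
    linarith
  · rw [starGen_some (fun n => (n : ℝ) + 1)]
    have h := k.pos
    have hd : 0 ≤ d * lam := by positivity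
    push_cast [Nat.cast_sub (show 1 ≤ (k : ℕ) by omega)]
    linarith

theorem starExitRate_le (hlam : 0 ≤ lam) (u : StarState d) :
    starExitRate d lam lam lam u ≤ (d + 2) * lam * (starLevel u + 1) := by
  have hd : 0 ≤ d * lam := by positivity
  rcases u with _ | ⟨i, k⟩
  · simp only [starExitRate, starLevel]
    push_cast
    linarith
  · simp only [starExitRate, starLevel]
    have : 0 ≤ (d : ℝ) * lam * ((k : ℝ) + 1) := by positivity
    linarith

theorem summable_level_of_eq (hP : IsStarTransition d lam lam lam P) (hlam : 0 ≤ lam)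
    {t : ℝ} (ht : 0 ≤ t) (u : StarState d) :
    Summable (fun v => P t u v * ((starLevel v : ℝ) + 1)) ∧
      ∑' v, P t u v * ((starLevel v : ℝ) + 1) ≤ starLevel u + 1 + (d + 1) * lam * t :=
  hP.summable_level hlam hlam hlam (by positivity) (starGen_level_le hlam) ht u

/-- The expectation at time `s` of the critical generating function for the remaining time. -/
noncomputable def interpolant (P : ℝ → StarState d → StarState d → ℝ) (lam w t s : ℝ) : ℝ :=
  starExpect P s (fun v => critGen lam w (t - s) (starLevel v)) none

variable {w : ℝ}

theorem tendsto_interpolant_slope (hP : IsStarTransition d lam lam lam P) (hlam : 0 ≤ lam)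
    (hw : 0 ≤ w) (hw2 : w ≤ 2) {s t : ℝ} (hs : 0 ≤ s) (hst : s < t) :
    Tendsto (fun h => (interpolant P lam w t (s + h) - interpolant P lam w t s) / h) (𝓝[>] 0)
      (𝓝 (P s none none * -((d - 1) * lam * w / (1 + lam * w * (t - s)) ^ 2))) := by
  set r := t - s with hr
  have hr0 : 0 < r := by linarith
  have hsmall : ∀ᶠ h in 𝓝[>] (0 : ℝ), 0 < h ∧ h < r := by
    filter_upwards [Ioo_mem_nhdsGT hr0] with h hh using hh
  set G : ℝ → StarState d → ℝ := fun τ v => critGen lam w τ (starLevel v) with hG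
  have hGle : ∀ τ, 0 ≤ τ → ∀ v, |G τ v| ≤ 1 := fun τ hτ v =>
    abs_critGen_le hlam hw hw2 hτ (starLevel v)
  have hGlim : ∀ v, Tendsto (fun h => G (r - h) v) (𝓝[>] 0) (𝓝 (G r v)) := fun v =>
    (hasDerivAt_critGen hlam hw hr0.le (starLevel v)).continuousAt.tendsto.comp
      (tendsto_sub_nhdsGT_zero r)
  have hlim1 : ∀ v, Tendsto (fun h => (starExpect P h (G (r - h)) v - G (r - h) v) / h) (𝓝[>] 0)
      (𝓝 (starGen lam lam lam (G r) v)) := fun v =>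
    hP.tendsto_expect_sub_div (g := fun h => G (r - h)) (B := 1) (by
      filter_upwards [hsmall] with h hh x
      exact hGle _ (by linarith [hh.2]) x) hGlim v
  have hlim2 : ∀ v : StarState d, Tendsto (fun h => (G (r - h) v - G r v) / h) (𝓝[>] 0)
      (𝓝 (-critGenDeriv lam w r (starLevel v))) := by
    intro v
    have h1 := (hasDerivAt_critGen hlam hw hr0.le (starLevel v)).tendsto_slope_zero
    have h2 : Tendsto (fun h : ℝ => -h) (𝓝[>] 0) (𝓝[≠] 0) := by
      refine tendsto_nhdsWithin_iff.mpr ⟨?_, ?_⟩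
      · have : Tendsto (fun h : ℝ => -h) (𝓝 0) (𝓝 (-0)) := continuous_neg.tendsto 0
        rw [neg_zero] at this
        exact this.mono_left nhdsWithin_le_nhds
      · filter_upwards [self_mem_nhdsWithin] with h hh
        exact neg_ne_zero.mpr (ne_of_gt hh)
    refine (h1.comp h2).neg.congr fun h => ?_
    simp only [Function.comp_apply, smul_eq_mul, hG, ← sub_eq_add_neg, inv_neg]
    ring
  -- The constant is `2(d + 2)λ`, from the exit rate bound on the semigroup increment, plus `4λ`,
  -- from the time increment of `critGen`. Both increments grow linearly in the level, which is why
  -- the first moment is needed.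
  have hdom : Summable fun v => P s none v * ((starLevel v : ℝ) + 1) * (2 * (d + 4) * lam) :=
    (hP.summable_level_of_eq hlam hs none).1.mul_right _
  have hmain := tendsto_tsum_of_dominated_convergence (𝓕 := 𝓝[>] (0 : ℝ))
    (f := fun h v => P s none v * ((starExpect P h (G (r - h)) v - G r v) / h))
    (g := fun v => P s none v *
      (starGen lam lam lam (G r) v - critGenDeriv lam w r (starLevel v))) hdom
    (fun v => by
      refine Tendsto.const_mul _ ?_
      rw [sub_eq_add_neg]
      refine ((hlim1 v).add (hlim2 v)).congr fun h => ?_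
      ring)
    (by
      filter_upwards [hsmall] with h hh v
      rw [norm_mul, Real.norm_of_nonneg (hP.nonneg s hs _ _), mul_assoc]
      refine mul_le_mul_of_nonneg_left ?_ (hP.nonneg s hs _ _)
      rw [Real.norm_eq_abs, abs_div, abs_of_pos hh.1, div_le_iff₀ hh.1]
      have h1 := hP.abs_expect_sub_le hh.1.le (hGle (r - h) (by linarith [hh.2])) v
      have h2 : |G (r - h) v - G r v| ≤ 4 * lam * ((starLevel v : ℝ) + 1) * |(r - h) - r| :=
        abs_critGen_sub_le hlam hw hw2 (by linarith [hh.2]) hr0.le (starLevel v)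
      rw [show r - h - r = -h by ring, abs_neg, abs_of_pos hh.1] at h2
      have h3 : starExitRate d lam lam lam v * h * (2 * 1) ≤
          (d + 2) * lam * (starLevel v + 1) * h * (2 * 1) := by
        have := starExitRate_le hlam v
        have := hh.1.le
        gcongr
      have h4 := abs_add_le (starExpect P h (G (r - h)) v - G (r - h) v) (G (r - h) v - G r v)
      rw [sub_add_sub_cancel] at h4
      linarith)
  have hval : ∑' v, P s none v *
      (starGen lam lam lam (G r) v - critGenDeriv lam w r (starLevel v)) =
      P s none none * -((d - 1) * lam * w / (1 + lam * w * r) ^ 2) := by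
    rw [tsum_eq_single none]
    · rw [← starGen_critGen_none d lam lam w r]
      rfl
    · rintro (_ | ⟨i, k⟩) hv
      · exact absurd rfl hv
      · rw [hG, starGen_critGen_some]
        simp [starLevel]
  rw [hval] at hmain
  refine hmain.congr' ?_
  filter_upwards [hsmall] with h hh
  have hb : ∀ v, |G (r - h) v| ≤ 1 := hGle _ (by linarith [hh.2])
  have h1 : interpolant P lam w t (s + h) =
      ∑' v, P s none v * starExpect P h (G (r - h)) v := by
    rw [interpolant, hP.expect_add hs hh.1.le (f := fun v => critGen lam w (t - (s + h))
      (starLevel v)) (B := 1)]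
    · rw [show t - (s + h) = r - h by rw [hr]; ring]
      rfl
    · rw [show t - (s + h) = r - h by rw [hr]; ring]
      exact hb
  have h2 : interpolant P lam w t s = ∑' v, P s none v * G r v := rfl
  rw [h1, h2, ← (hP.summable_mul hs (hP.abs_expect_le hh.1.le hb) none).tsum_sub
    (hP.summable_mul hs (hGle r hr0.le) none), ← tsum_div_const]
  exact tsum_congr fun v => by ring

theorem hasDerivWithinAt_interpolant (hP : IsStarTransition d lam lam lam P) (hlam : 0 ≤ lam)
    (hw : 0 ≤ w) (hw2 : w ≤ 2) {s t : ℝ} (hs : 0 ≤ s) (hst : s < t) :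
    HasDerivWithinAt (interpolant P lam w t)
      (P s none none * -((d - 1) * lam * w / (1 + lam * w * (t - s)) ^ 2)) (Set.Ioi s) s := by
  rw [hasDerivWithinAt_iff_tendsto_slope' Set.self_notMem_Ioi]
  have h1 : Tendsto (fun y => y - s) (𝓝[>] s) (𝓝[>] 0) := by
    refine tendsto_nhdsWithin_iff.mpr ⟨?_, ?_⟩
    · have : Tendsto (fun y : ℝ => y - s) (𝓝 s) (𝓝 (s - s)) := by
        apply Continuous.tendsto
        fun_prop
      rw [sub_self] at this
      exact this.mono_left nhdsWithin_le_nhds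
    · filter_upwards [self_mem_nhdsWithin] with y hy
      exact Set.mem_Ioi.mpr (sub_pos.mpr hy)
  refine ((hP.tendsto_interpolant_slope hlam hw hw2 hs hst).comp h1).congr fun y => ?_
  rw [Function.comp_apply, slope_def_field, add_sub_cancel]

/-- The right derivative is available only for `s < t`, so continuity up to the endpoint is supplied
separately, by a Lipschitz bound that again uses the first moment. -/
theorem continuousOn_interpolant (hP : IsStarTransition d lam lam lam P) (hlam : 0 ≤ lam)
    (hw : 0 ≤ w) (hw2 : w ≤ 2) {t : ℝ} :
    ContinuousOn (interpolant P lam w t) (Set.Icc 0 t) := by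
  set K := 4 * lam * (1 + (d + 1) * lam * t) + starExitRate d lam lam lam none * 2 with hK
  have key : ∀ r ∈ Set.Icc 0 t, ∀ s ∈ Set.Icc 0 t,
      |interpolant P lam w t s - interpolant P lam w t r| ≤ K * |s - r| := by
    intro r hr s hs
    have hb : ∀ x ∈ Set.Icc 0 t, ∀ v : StarState d, |critGen lam w (t - x) (starLevel v)| ≤ 1 :=
      fun x hx v => abs_critGen_le hlam hw hw2 (by linarith [hx.2]) _
    have h1 := hP.abs_expect_sub_expect_le hs.1 hr.1 (hb r hr) none
    have h2 : |interpolant P lam w t s -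
        starExpect P s (fun v => critGen lam w (t - r) (starLevel v)) none| ≤
        (1 + (d + 1) * lam * t) * (4 * lam * |s - r|) := by
      have hsum := hP.summable_level_of_eq hlam hs.1 (none : StarState d)
      have h3 : (∑' v, P s none v * ((starLevel v : ℝ) + 1)) * (4 * lam * |s - r|) ≤
          (1 + (d + 1) * lam * t) * (4 * lam * |s - r|) := by
        have h4 : (∑' v, P s none v * ((starLevel v : ℝ) + 1)) ≤ 1 + (d + 1) * lam * t := by
          refine hsum.2.trans ?_
          have : (d + 1) * lam * s ≤ (d + 1) * lam * t := by
            have := hs.2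
            gcongr
          simpa [starLevel] using this
        gcongr
      refine le_trans ?_ h3
      rw [interpolant, starExpect, starExpect, ← (hP.summable_mul hs.1 (hb s hs) none).tsum_sub
        (hP.summable_mul hs.1 (hb r hr) none), ← Real.norm_eq_abs]
      refine tsum_of_norm_bounded (hsum.1.hasSum.mul_right _) fun v => ?_
      rw [← mul_sub, norm_mul, Real.norm_of_nonneg (hP.nonneg s hs.1 _ _), mul_assoc]
      refine mul_le_mul_of_nonneg_left ?_ (hP.nonneg s hs.1 _ _)
      have h5 := abs_critGen_sub_le hlam hw hw2 (sub_nonneg.mpr hs.2) (sub_nonneg.mpr hr.2)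
        (starLevel v)
      rw [show t - s - (t - r) = -(s - r) by ring, abs_neg] at h5
      rw [Real.norm_eq_abs]
      linarith
    have h3 := abs_add_le (interpolant P lam w t s -
      starExpect P s (fun v => critGen lam w (t - r) (starLevel v)) none)
      (starExpect P s (fun v => critGen lam w (t - r) (starLevel v)) none -
        interpolant P lam w t r)
    rw [sub_add_sub_cancel] at h3
    refine h3.trans ?_
    have h4 : |starExpect P s (fun v => critGen lam w (t - r) (starLevel v)) none -
        interpolant P lam w t r| ≤ starExitRate d lam lam lam none * |s - r| * (2 * 1) := h1
    rw [hK]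
    linarith
  intro r hr
  rw [ContinuousWithinAt, tendsto_iff_dist_tendsto_zero]
  have h1 : Tendsto (fun s => K * |s - r|) (𝓝[Set.Icc 0 t] r) (𝓝 (K * |r - r|)) := by
    apply Continuous.continuousWithinAt
    fun_prop
  rw [sub_self, abs_zero, mul_zero] at h1
  refine squeeze_zero' (Eventually.of_forall fun _ => dist_nonneg) ?_ h1
  filter_upwards [self_mem_nhdsWithin] with s hs
  exact key r hr s hs

theorem continuousOn_apply (hP : IsStarTransition d lam lam lam P) (u v : StarState d) :
    ContinuousOn (fun t => P t u v) (Set.Ici 0) := by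
  classical
  have h := hP.continuousOn_expect (f := fun x => if x = v then 1 else 0) (B := 1)
    (fun x => by split_ifs <;> simp) u
  refine h.congr fun t _ => ?_
  simp [starExpect]

/-- Duhamel's formula for the generating function of the walk, as a perturbation of the case of
one ray. -/
theorem expect_pow_level (hP : IsStarTransition d lam lam lam P) (hlam : 0 ≤ lam)
    (hw : 0 ≤ w) (hw2 : w ≤ 2) {t : ℝ} (ht : 0 ≤ t) :
    starExpect P t (fun v => (1 - w) ^ starLevel v) none = 1 / (1 + lam * w * t) -
      (d - 1) * lam * w * ∫ s in (0 : ℝ)..t, P s none none / (1 + lam * w * (t - s)) ^ 2 := by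
  have hint : IntervalIntegrable
      (fun s => P s none none * -((d - 1) * lam * w / (1 + lam * w * (t - s)) ^ 2)) volume 0 t := by
    apply ContinuousOn.intervalIntegrable_of_Icc ht
    refine ((hP.continuousOn_apply none none).mono Set.Icc_subset_Ici_self).mul ?_
    refine ContinuousOn.neg (ContinuousOn.div (by fun_prop) (by fun_prop) fun s hs => ?_)
    have := one_le_critDenom hlam hw (sub_nonneg.mpr hs.2)
    positivity
  have h := intervalIntegral.integral_eq_sub_of_hasDeriv_right_of_le ht
    (hP.continuousOn_interpolant hlam hw hw2)
    (fun s hs => hP.hasDerivWithinAt_interpolant hlam hw hw2 hs.1.le hs.2) hint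
  -- At `s = t` no time remains and `critGen` reduces to `(1 - w) ^ level`; at `s = 0` the walk is
  -- at the origin.
  have h1 : interpolant P lam w t t = starExpect P t (fun v => (1 - w) ^ starLevel v) none := by
    simp [interpolant, critGen]
  have h0 : interpolant P lam w t 0 = 1 / (1 + lam * w * t) := by
    rw [interpolant, hP.expect_zero]
    simp [critGen, starLevel]
  rw [h1, h0] at h
  have h2 : ∫ s in (0 : ℝ)..t,
      P s none none * -((d - 1) * lam * w / (1 + lam * w * (t - s)) ^ 2) =
      -((d - 1) * lam * w * ∫ s in (0 : ℝ)..t, P s none none / (1 + lam * w * (t - s)) ^ 2) := by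
    rw [← intervalIntegral.integral_const_mul, ← intervalIntegral.integral_neg]
    refine intervalIntegral.integral_congr fun s _ => ?_
    ring
  linarith

end IsStarTransition

/-! ### The Volterra equation and the permutation series. -/

theorem hasSum_intervalIntegral_of_bound {ι : Type*} [Countable ι] {F : ι → ℝ → ℝ} {f : ℝ → ℝ}
    {b : ι → ℝ} {t : ℝ} (ht : 0 ≤ t) (hF : ∀ i, ContinuousOn (F i) (Set.Icc 0 t))
    (hb : ∀ i, ∀ s ∈ Set.Icc 0 t, |F i s| ≤ b i) (hsum : Summable b)
    (hf : ∀ s ∈ Set.Icc 0 t, HasSum (fun i => F i s) (f s)) :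
    HasSum (fun i => ∫ s in (0 : ℝ)..t, F i s) (∫ s in (0 : ℝ)..t, f s) := by
  have hI : ∀ s ∈ Set.uIoc 0 t, s ∈ Set.Icc 0 t := fun s hs => by
    rw [Set.uIoc_of_le ht] at hs
    exact Set.Ioc_subset_Icc_self hs
  refine intervalIntegral.hasSum_integral_of_dominated_convergence (fun i _ => b i) (fun i => ?_)
    (fun i => Eventually.of_forall fun s hs => hb i s (hI s hs))
    (Eventually.of_forall fun _ _ => hsum) (by simp)
    (Eventually.of_forall fun s hs => hf s (hI s hs))
  rw [Set.uIoc_of_le ht]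
  exact ((hF i).mono Set.Ioc_subset_Icc_self).aestronglyMeasurable measurableSet_Ioc

/-- Iterating the inequality from a uniform bound `M` gives `M (Ks)^n / n!` for every `n`, which
tends to `0`. -/
theorem eq_zero_of_le_mul_integral {δ : ℝ → ℝ} {T K : ℝ} (hK : 0 ≤ K)
    (hδ : ContinuousOn δ (Set.Icc 0 T))
    (h : ∀ s ∈ Set.Icc 0 T, |δ s| ≤ K * ∫ r in (0 : ℝ)..s, |δ r|) :
    ∀ s ∈ Set.Icc 0 T, δ s = 0 := by
  obtain ⟨M, hM⟩ := isCompact_Icc.exists_bound_of_continuousOn hδ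
  have key : ∀ n : ℕ, ∀ s ∈ Set.Icc 0 T, |δ s| ≤ M * ((K * s) ^ n / (n.factorial : ℝ)) := by
    intro n
    induction n with
    | zero => intro s hs; simpa using hM s hs
    | succ n ih =>
      intro s hs
      refine (h s hs).trans ?_
      have h1 : ∫ r in (0 : ℝ)..s, |δ r| ≤
          ∫ r in (0 : ℝ)..s, M * ((K * r) ^ n / (n.factorial : ℝ)) := by
        refine intervalIntegral.integral_mono_on hs.1 ?_ ?_ fun r hr =>
          ih r ⟨hr.1, hr.2.trans hs.2⟩
        · exact ((hδ.mono (Set.Icc_subset_Icc_right hs.2)).abs).intervalIntegrable_of_Icc hs.1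
        · exact Continuous.intervalIntegrable (by fun_prop) _ _
      have h2 : ∫ r in (0 : ℝ)..s, M * ((K * r) ^ n / (n.factorial : ℝ)) =
          M * (K ^ n / (n.factorial : ℝ)) * (s ^ (n + 1) / (n + 1)) := by
        have : ∀ r : ℝ, M * ((K * r) ^ n / (n.factorial : ℝ)) =
            M * (K ^ n / (n.factorial : ℝ)) * r ^ n := fun r => by rw [mul_pow]; ring
        simp only [this]
        rw [intervalIntegral.integral_const_mul, integral_pow]
        simp
      rw [h2] at h1
      refine (mul_le_mul_of_nonneg_left h1 hK).trans (le_of_eq ?_)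
      rw [Nat.factorial_succ, mul_pow, pow_succ K]
      push_cast
      field_simp
  intro s hs
  have h1 : Tendsto (fun n : ℕ => M * ((K * s) ^ n / (n.factorial : ℝ))) atTop (𝓝 (M * 0)) :=
    (FloorSemiring.tendsto_pow_div_factorial_atTop (K * s)).const_mul M
  rw [mul_zero] at h1
  have h2 := ge_of_tendsto' h1 fun n => key n s hs
  exact abs_eq_zero.mp (le_antisymm h2 (abs_nonneg _))

/-- Uniqueness of the solution of a Volterra equation with a kernel bounded by `1`. -/
theorem eqOn_of_volterra {φ ψ a : ℝ → ℝ} {k : ℝ → ℝ} {T c : ℝ}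
    (hφ : ContinuousOn φ (Set.Icc 0 T)) (hψ : ContinuousOn ψ (Set.Icc 0 T))
    (hk : ContinuousOn k (Set.Icc 0 T)) (hk1 : ∀ s ∈ Set.Icc 0 T, |k s| ≤ 1)
    (h1 : ∀ s ∈ Set.Icc 0 T, φ s = a s + c * ∫ r in (0 : ℝ)..s, φ r * k (s - r))
    (h2 : ∀ s ∈ Set.Icc 0 T, ψ s = a s + c * ∫ r in (0 : ℝ)..s, ψ r * k (s - r)) :
    Set.EqOn φ ψ (Set.Icc 0 T) := by
  have key := eq_zero_of_le_mul_integral (δ := fun s => φ s - ψ s) (T := T) (abs_nonneg c)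
    (hφ.sub hψ) (by
      intro s hs
      have hsub : Set.Icc 0 s ⊆ Set.Icc 0 T := Set.Icc_subset_Icc_right hs.2
      have hk' : ContinuousOn (fun r => k (s - r)) (Set.Icc 0 s) := by
        refine hk.comp (by fun_prop) fun r hr => ?_
        exact ⟨by linarith [hr.2], by linarith [hr.1, hs.2]⟩
      have i1 : IntervalIntegrable (fun r => φ r * k (s - r)) volume 0 s :=
        ((hφ.mono hsub).mul hk').intervalIntegrable_of_Icc hs.1
      have i2 : IntervalIntegrable (fun r => ψ r * k (s - r)) volume 0 s :=
        ((hψ.mono hsub).mul hk').intervalIntegrable_of_Icc hs.1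
      have e : φ s - ψ s = c * ∫ r in (0 : ℝ)..s, (φ r - ψ r) * k (s - r) := by
        rw [h1 s hs, h2 s hs, add_sub_add_left_eq_sub, ← mul_sub,
          ← intervalIntegral.integral_sub i1 i2]
        congr 1
        exact intervalIntegral.integral_congr fun r _ => by ring
      rw [e, abs_mul]
      refine mul_le_mul_of_nonneg_left ?_ (abs_nonneg c)
      refine (intervalIntegral.abs_integral_le_integral_abs hs.1).trans ?_
      have hd : ContinuousOn (fun r => φ r - ψ r) (Set.Icc 0 s) :=
        (hφ.mono hsub).sub (hψ.mono hsub)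
      refine intervalIntegral.integral_mono_on hs.1
        ((hd.mul hk').abs.intervalIntegrable_of_Icc hs.1)
        (hd.abs.intervalIntegrable_of_Icc hs.1) fun r hr => ?_
      rw [abs_mul]
      exact mul_le_of_le_one_right (abs_nonneg _)
        (hk1 _ ⟨by linarith [hr.2], by linarith [hr.1, hs.2]⟩))
  exact fun s hs => sub_eq_zero.mp (key s hs)

/-- The Beta integral, by parts in `m`. It evaluates the convolution of two power series term by
term. -/
theorem integral_pow_mul_sub_pow (s : ℝ) (j m : ℕ) :
    ∫ r in (0 : ℝ)..s, r ^ j * (s - r) ^ m =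
      (j.factorial * m.factorial : ℝ) / ((j + m + 1).factorial : ℝ) * s ^ (j + m + 1) := by
  induction m generalizing j with
  | zero =>
    simp only [pow_zero, mul_one, integral_pow, Nat.factorial_zero, add_zero, Nat.factorial_succ]
    push_cast
    have : (0 : ℝ) < j.factorial := by positivity
    field_simp
    simp
  | succ m ih =>
    have h := intervalIntegral.integral_mul_deriv_eq_deriv_mul (a := 0) (b := s)
      (u := fun r => (s - r) ^ (m + 1)) (u' := fun r => -((m + 1) * (s - r) ^ m))
      (v := fun r => r ^ (j + 1) / (j + 1)) (v' := fun r => r ^ j)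
      (fun r _ => by
        have := ((hasDerivAt_id r).const_sub s).pow (m + 1)
        refine this.congr_deriv ?_
        simp)
      (fun r _ => by
        have := (hasDerivAt_pow (j + 1) r).div_const ((j : ℝ) + 1)
        refine this.congr_deriv ?_
        push_cast
        field_simp)
      (Continuous.intervalIntegrable (by fun_prop) _ _)
      (Continuous.intervalIntegrable (by fun_prop) _ _)
    have e1 : ∫ r in (0 : ℝ)..s, r ^ j * (s - r) ^ (m + 1) =
        ∫ r in (0 : ℝ)..s, (s - r) ^ (m + 1) * r ^ j :=
      intervalIntegral.integral_congr fun r _ => mul_comm _ _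
    have e2 : ∫ r in (0 : ℝ)..s, -((m + 1 : ℝ) * (s - r) ^ m) * (r ^ (j + 1) / (j + 1)) =
        -((m + 1) / (j + 1)) * ∫ r in (0 : ℝ)..s, r ^ (j + 1) * (s - r) ^ m := by
      rw [← intervalIntegral.integral_const_mul]
      exact intervalIntegral.integral_congr fun r _ => by ring
    rw [e1, h, e2, ih (j + 1)]
    rw [show j + 1 + m + 1 = j + (m + 1) + 1 by ring, Nat.factorial_succ j, Nat.factorial_succ m]
    push_cast
    have : (0 : ℝ) < (j + (m + 1) + 1).factorial := by positivity
    field_simp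
    simp

/-- The exponential generating function of the permutations by the number of components. -/
noncomputable def permSeries (d : ℕ) (x : ℝ) : ℝ :=
  ∑' n : ℕ, x ^ n / (n.factorial : ℝ) * permSum d n

theorem permSeries_hasSum (d : ℕ) {x : ℝ} (hx : |x| < 1) :
    HasSum (fun n : ℕ => x ^ n / (n.factorial : ℝ) * permSum d n) (permSeries d x) := by
  refine Summable.hasSum (Summable.of_norm_bounded (summable_permSum d (abs_nonneg x) hx) ?_)
  intro n
  rw [norm_mul, norm_div, norm_pow, Real.norm_of_nonneg (permSum_nonneg (by positivity) n),
    Real.norm_of_nonneg (by positivity : (0 : ℝ) ≤ n.factorial), Real.norm_eq_abs]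

theorem abs_permTerm_le (d : ℕ) {x y : ℝ} (h : |x| ≤ y) (n : ℕ) :
    |x ^ n / (n.factorial : ℝ) * permSum d n| ≤ y ^ n / (n.factorial : ℝ) * permSum d n := by
  have h1 := permSum_nonneg (Nat.cast_nonneg (α := ℝ) d) n
  rw [abs_mul, abs_div, abs_pow, abs_of_nonneg h1,
    abs_of_nonneg (by positivity : (0 : ℝ) ≤ n.factorial)]
  gcongr

theorem continuousOn_permSeries (d : ℕ) {lam T : ℝ} (hlam : 0 ≤ lam) (hT : lam * T < 1) :
    ContinuousOn (fun s => permSeries d (-(lam * s))) (Set.Icc 0 T) := by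
  rcases lt_or_ge T 0 with hT0 | hT0
  · rw [Set.Icc_eq_empty hT0.not_ge]
    exact continuousOn_empty _
  refine continuousOn_tsum (u := fun n => (lam * T) ^ n / (n.factorial : ℝ) * permSum d n)
    (fun n => by fun_prop) (summable_permSum d (by positivity) hT) fun n s hs => ?_
  refine abs_permTerm_le d ?_ n
  rw [abs_neg, abs_of_nonneg (mul_nonneg hlam hs.1)]
  exact mul_le_mul_of_nonneg_left hs.2 hlam

theorem hasSum_succ_mul_pow {x : ℝ} (hx : |x| < 1) :
    HasSum (fun m : ℕ => ((m : ℝ) + 1) * x ^ m) (1 / (1 - x) ^ 2) := by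
  have h := hasSum_choose_mul_geometric_of_norm_lt_one 1 (r := x) hx
  simpa using h

/-- Since `1/(1+x)² = ∑ (m+1)(-x)^m`, the Beta integral gives the pair `(j, m)` the weight `(m+1)!
permSum d j / (j+m+1)!`. Collecting `j + m = n` reproduces `permSum_recurrence` at `n + 1`; its
leading factorial accounts for `1/(1+λs)`. -/
theorem permSeries_volterra (d : ℕ) {lam s : ℝ} (hlam : 0 ≤ lam) (hs : 0 ≤ s)
    (hls : lam * s < 1) :
    permSeries d (-(lam * s)) = 1 / (1 + lam * s) + (-((d - 1) * lam)) *
      ∫ r in (0 : ℝ)..s, permSeries d (-(lam * r)) * (1 / (1 + lam * (s - r)) ^ 2) := by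
  have hx0 : 0 ≤ lam * s := mul_nonneg hlam hs
  set x := lam * s with hx
  have hle : ∀ r ∈ Set.Icc 0 s, |(-(lam * r))| ≤ x := fun r hr => by
    rw [abs_neg, abs_of_nonneg (mul_nonneg hlam hr.1)]
    exact mul_le_mul_of_nonneg_left hr.2 hlam
  have hle' : ∀ r ∈ Set.Icc 0 s, |(-(lam * (s - r)))| ≤ x := fun r hr =>
    hle (s - r) ⟨by linarith [hr.2], by linarith [hr.1]⟩
  have habsx : |x| < 1 := by rwa [abs_of_nonneg hx0]
  set F : ℕ × ℕ → ℝ → ℝ := fun p r =>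
    ((-(lam * r)) ^ p.1 / (p.1.factorial : ℝ) * permSum d p.1) *
      (((p.2 : ℝ) + 1) * (-(lam * (s - r))) ^ p.2) with hF
  set b : ℕ × ℕ → ℝ := fun p =>
    (x ^ p.1 / (p.1.factorial : ℝ) * permSum d p.1) * (((p.2 : ℝ) + 1) * x ^ p.2) with hb
  have hsum1 := summable_permSum d hx0 hls
  have hsum2 := (hasSum_succ_mul_pow habsx).summable
  have hbsum : Summable b := hsum1.mul_of_nonneg hsum2
    (fun n => mul_nonneg (by positivity) (permSum_nonneg (by positivity) n))
    (fun n => by positivity)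
  have hFb : ∀ p, ∀ r ∈ Set.Icc 0 s, |F p r| ≤ b p := by
    intro p r hr
    have h1 := abs_permTerm_le d (hle r hr) p.1
    have h2 : |((p.2 : ℝ) + 1) * (-(lam * (s - r))) ^ p.2| ≤ ((p.2 : ℝ) + 1) * x ^ p.2 := by
      rw [abs_mul, abs_pow, abs_of_nonneg (by positivity : (0 : ℝ) ≤ (p.2 : ℝ) + 1)]
      have := hle' r hr
      gcongr
    rw [hF, abs_mul]
    exact mul_le_mul h1 h2 (abs_nonneg _) ((abs_nonneg _).trans h1)
  have hFsum : ∀ r ∈ Set.Icc 0 s, HasSum (fun p => F p r)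
      (permSeries d (-(lam * r)) * (1 / (1 + lam * (s - r)) ^ 2)) := by
    intro r hr
    have h1 := permSeries_hasSum d ((hle r hr).trans_lt hls)
    have h2 := hasSum_succ_mul_pow ((hle' r hr).trans_lt hls)
    rw [sub_neg_eq_add] at h2
    exact h1.mul h2 (Summable.of_norm_bounded hbsum fun p => hFb p r hr)
  have hint := hasSum_intervalIntegral_of_bound hs (fun p => by simp only [hF]; fun_prop) hFb
    hbsum hFsum
  have hval : ∀ p : ℕ × ℕ, ∫ r in (0 : ℝ)..s, F p r =
      ((p.2 + 1).factorial : ℝ) * permSum d p.1 * ((-lam) ^ (p.1 + p.2) * s ^ (p.1 + p.2 + 1)) /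
        ((p.1 + p.2 + 1).factorial : ℝ) := by
    intro p
    have h1 : ∀ r, F p r = ((p.2 : ℝ) + 1) * permSum d p.1 * (-lam) ^ (p.1 + p.2) /
        (p.1.factorial : ℝ) * (r ^ p.1 * (s - r) ^ p.2) := fun r => by
      simp only [hF, ← neg_mul, mul_pow, pow_add]
      ring
    simp only [h1]
    rw [intervalIntegral.integral_const_mul, integral_pow_mul_sub_pow, Nat.factorial_succ p.2]
    push_cast
    have := Nat.factorial_pos p.1
    have := Nat.factorial_pos (p.1 + p.2 + 1)
    field_simp
  simp only [hval] at hint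
  have hanti := (Finset.HasAntidiagonal.sigmaAntidiagonalEquivProd.hasSum_iff.mpr hint).sigma
    (fun n => hasSum_fintype _)
  have hgeom : HasSum (fun n : ℕ => (-x) ^ (n + 1)) (1 / (1 + x) - 1) := by
    have h1 := hasSum_geometric_of_norm_lt_one (ξ := -x) (by rwa [norm_neg])
    rw [sub_neg_eq_add] at h1
    have := (hasSum_nat_add_iff' 1).mpr h1
    simpa using this
  have hrec := hgeom.add (hanti.mul_left (-((d - 1) * lam)))
  have hps : HasSum (fun n : ℕ => (-x) ^ (n + 1) / ((n + 1).factorial : ℝ) * permSum d (n + 1))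
      (permSeries d (-x) - 1) := by
    have h1 := permSeries_hasSum d (x := -x) (by rwa [abs_neg])
    have := (hasSum_nat_add_iff' 1).mpr h1
    simpa [permSum_zero] using this
  have hfin : (fun n : ℕ => (-x) ^ (n + 1) / ((n + 1).factorial : ℝ) * permSum d (n + 1)) =
      fun n : ℕ => (-x) ^ (n + 1) + -((d - 1) * lam) *
        ∑ p : Finset.HasAntidiagonal.antidiagonal n, (((p : ℕ × ℕ).2 + 1).factorial : ℝ) *
          permSum d (p : ℕ × ℕ).1 * ((-lam) ^ ((p : ℕ × ℕ).1 + (p : ℕ × ℕ).2) *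
            s ^ ((p : ℕ × ℕ).1 + (p : ℕ × ℕ).2 + 1)) /
              (((p : ℕ × ℕ).1 + (p : ℕ × ℕ).2 + 1).factorial : ℝ) := by
    funext n
    rw [Finset.sum_coe_sort (Finset.HasAntidiagonal.antidiagonal n) (fun p : ℕ × ℕ =>
      ((p.2 + 1).factorial : ℝ) * permSum d p.1 * ((-lam) ^ (p.1 + p.2) * s ^ (p.1 + p.2 + 1)) /
        ((p.1 + p.2 + 1).factorial : ℝ))]
    have h1 : ∀ p ∈ Finset.HasAntidiagonal.antidiagonal n,
        ((p.2 + 1).factorial : ℝ) * permSum d p.1 *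
          ((-lam) ^ (p.1 + p.2) * s ^ (p.1 + p.2 + 1)) / ((p.1 + p.2 + 1).factorial : ℝ) =
        ((p.2 + 1).factorial : ℝ) * permSum d p.1 *
          ((-lam) ^ n * s ^ (n + 1) / ((n + 1).factorial : ℝ)) := by
      intro p hp
      rw [Finset.HasAntidiagonal.mem_antidiagonal.mp hp]
      ring
    -- The antidiagonal is swapped so that the summation index belongs to the factorial, as in the
    -- recurrence.
    rw [Finset.sum_congr rfl h1, ← Finset.sum_mul, ← Finset.Nat.sum_antidiagonal_swap]
    simp only [Prod.snd_swap, Prod.fst_swap]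
    rw [Finset.Nat.sum_antidiagonal_eq_sum_range_succ
        (fun i j => ((i + 1).factorial : ℝ) * permSum d j), permSum_recurrence]
    simp only [Nat.add_sub_cancel, hx, ← neg_mul, mul_pow, Nat.succ_eq_add_one]
    have := Nat.factorial_pos (n + 1)
    field_simp
    ring
  rw [hfin] at hps
  have := hps.unique hrec
  linarith

/-! ### Hypergeometric series as integrals, and the one-ray law. -/

theorem hasSum_of_eq {ι : Type*} {f g : ι → ℝ} {a b : ℝ} (h : HasSum g b) (hf : ∀ i, f i = g i)
    (hab : a = b) : HasSum f a := by
  rw [hab, funext hf]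
  exact h

theorem ascPochhammer_eval_div_eval_add_one {a : ℝ} (ha : 0 < a) (r : ℕ) :
    (ascPochhammer ℝ r).eval a / (ascPochhammer ℝ r).eval (a + 1) = a / (a + r) := by
  induction r with
  | zero => simp [ha.ne']
  | succ r ih =>
    rw [ascPochhammer_succ_eval, ascPochhammer_succ_eval, mul_div_mul_comm, ih]
    push_cast
    field_simp
    ring

theorem hasSum_ordinaryHypergeometric_one {a v : ℝ} (ha : 0 < a) (hv : |v| < 1) :
    HasSum (fun r : ℕ => a / (a + r) * v ^ r) (ordinaryHypergeometric (1 : ℝ) a (a + 1) v) := by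
  have hterm : ordinaryHypergeometric (1 : ℝ) a (a + 1) v = ∑' r : ℕ, a / (a + r) * v ^ r := by
    rw [ordinaryHypergeometric_eq_tsum]
    refine tsum_congr fun r => ?_
    rw [ascPochhammer_eval_one, ← ascPochhammer_eval_div_eval_add_one ha, smul_eq_mul]
    have : (r.factorial : ℝ) ≠ 0 := by positivity
    field_simp
  rw [hterm]
  refine Summable.hasSum (Summable.of_norm_bounded
    (summable_geometric_of_lt_one (abs_nonneg v) hv) fun r => ?_)
  rw [norm_mul, norm_pow, Real.norm_eq_abs v, Real.norm_of_nonneg (by positivity)]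
  refine mul_le_of_le_one_left (by positivity) ((div_le_one (by positivity)).mpr ?_)
  have : (0 : ℝ) ≤ r := by positivity
  linarith

/-- Here `(-m)_i = (-1)^i i! C(m,i)`: the two signs cancel, `(1)_i = i!`, and the terms beyond `k`
vanish. -/
theorem ordinaryHypergeometric_neg_neg_one (r k : ℕ) (y : ℝ) :
    ordinaryHypergeometric (-(r : ℝ)) (-(k : ℝ)) 1 y =
      ∑ i ∈ Finset.range (k + 1), (r.choose i : ℝ) * (k.choose i : ℝ) * y ^ i := by
  have hneg : ∀ m i : ℕ, (ascPochhammer ℝ i).eval (-(m : ℝ)) =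
      (-1) ^ i * ((i.factorial : ℝ) * (m.choose i : ℝ)) := fun m i => by
    rw [ascPochhammer_eval_neg_eq_descPochhammer, descPochhammer_eval_eq_descFactorial,
      Nat.descFactorial_eq_factorial_mul_choose]
    push_cast
    ring
  rw [ordinaryHypergeometric_eq_tsum]
  simp only [hneg, ascPochhammer_eval_one, smul_eq_mul]
  rw [tsum_eq_sum (s := Finset.range (k + 1))]
  · refine Finset.sum_congr rfl fun i _ => ?_
    have : (i.factorial : ℝ) ≠ 0 := by positivity
    have h1 : ((-1 : ℝ) ^ i) * (-1) ^ i = 1 := by rw [← mul_pow]; simp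
    field_simp
    linear_combination ((r.choose i : ℝ) * (k.choose i : ℝ) * y ^ i) * h1
  · intro i hi
    rw [Nat.choose_eq_zero_of_lt (n := k) (k := i) (by simpa using hi)]
    simp

theorem hasSum_choose_mul_pow (i : ℕ) {q : ℝ} (hq : |q| < 1) :
    HasSum (fun r : ℕ => (r.choose i : ℝ) * q ^ r) (q ^ i / (1 - q) ^ (i + 1)) := by
  have h := (hasSum_choose_mul_geometric_of_norm_lt_one i (r := q) hq).mul_left (q ^ i)
  have h1 : HasSum (fun n : ℕ => ((n + i).choose i : ℝ) * q ^ (n + i)) (q ^ i / (1 - q) ^ (i + 1)) := by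
    refine hasSum_of_eq (h) (fun n => ?_) ?_
    · ring
    · ring
  have h2 := (hasSum_nat_add_iff (f := fun r : ℕ => (r.choose i : ℝ) * q ^ r) i).mp h1
  rwa [Finset.sum_eq_zero, add_zero] at h2
  intro r hr
  rw [Nat.choose_eq_zero_of_lt (Finset.mem_range.mp hr)]
  simp

/-- Sum over `r` first, by the negative binomial series; the binomial theorem then sums over `i`. -/
theorem hasSum_pow_mul_hypergeometric {q y : ℝ} (hq : |q| < 1) (k : ℕ) :
    HasSum (fun r : ℕ => q ^ r * ordinaryHypergeometric (-(r : ℝ)) (-(k : ℝ)) 1 y)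
      ((1 - q + q * y) ^ k / (1 - q) ^ (k + 1)) := by
  have hq1 : 0 < 1 - q := by linarith [(abs_lt.mp hq).2]
  have h := hasSum_sum (s := Finset.range (k + 1)) (f := fun i (r : ℕ) =>
    (r.choose i : ℝ) * q ^ r * ((k.choose i : ℝ) * y ^ i)) (a := fun i =>
    q ^ i / (1 - q) ^ (i + 1) * ((k.choose i : ℝ) * y ^ i))
    fun i _ => (hasSum_choose_mul_pow i hq).mul_right _
  refine hasSum_of_eq (h) (fun r => ?_) ?_
  · rw [ordinaryHypergeometric_neg_neg_one, Finset.mul_sum]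
    exact Finset.sum_congr rfl fun i _ => by ring
  · have e : (1 - q + q * y) ^ k / (1 - q) ^ (k + 1) = (q * y / (1 - q) + 1) ^ k / (1 - q) := by
      rw [show q * y / (1 - q) + 1 = (1 - q + q * y) / (1 - q) by field_simp; ring, div_pow,
        pow_succ]
      field_simp
    rw [e, add_pow, Finset.sum_div]
    refine Finset.sum_congr rfl fun i _ => ?_
    rw [one_pow, div_pow, mul_pow, pow_succ]
    field_simp

/-- With `v = ct/(1+ct)` the denominator factors as `1 + c(t-s) = (1+ct)(1 - v s/t)`. Expanding the
inverse square and integrating produces `(r+1)/(n+r+1) = 1 - n/(n+r+1)`: a geometric series minus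
the hypergeometric one. -/
theorem integral_pow_div_sq {c t : ℝ} (hc : 0 ≤ c) (ht : 0 ≤ t) (n : ℕ) :
    ∫ s in (0 : ℝ)..t, s ^ n / (1 + c * (t - s)) ^ 2 =
      t ^ (n + 1) * (1 / (1 + c * t) - n / (n + 1) *
        ordinaryHypergeometric (1 : ℝ) ((n : ℝ) + 1) ((n : ℝ) + 2) (1 - 1 / (1 + c * t)) /
          (1 + c * t) ^ 2) := by
  rcases ht.eq_or_lt with rfl | htpos
  · simp
  have hy : 0 ≤ c * t := by positivity
  set y := c * t with hyd
  set v := 1 - 1 / (1 + y) with hv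
  have hv' : v = y / (1 + y) := by rw [hv]; field_simp; ring
  have hv0 : 0 ≤ v := by rw [hv']; positivity
  have hv1 : v < 1 := by
    have : 0 < 1 / (1 + y) := by positivity
    linarith
  have hva : |v| < 1 := by rwa [abs_of_nonneg hv0]
  have hsum := (hasSum_succ_mul_pow hva)
  have hint := hasSum_intervalIntegral_of_bound (t := t)
    (F := fun (r : ℕ) s => s ^ n * (1 / (1 + y) ^ 2 * (((r : ℝ) + 1) * (v * (s / t)) ^ r)))
    (f := fun s => s ^ n / (1 + c * (t - s)) ^ 2)
    (b := fun r => t ^ n * (1 / (1 + y) ^ 2 * (((r : ℝ) + 1) * v ^ r))) ht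
    (fun r => by fun_prop) (fun r s hs => ?_) ((hsum.summable.mul_left _).mul_left _)
    (fun s hs => ?_)
  · have hval : ∀ r : ℕ, ∫ s in (0 : ℝ)..t,
        s ^ n * (1 / (1 + y) ^ 2 * (((r : ℝ) + 1) * (v * (s / t)) ^ r)) =
        t ^ (n + 1) / (1 + y) ^ 2 * (v ^ r - n / (n + 1) * (((n : ℝ) + 1) / (n + 1 + r) * v ^ r)) := by
      intro r
      have h1 : ∀ s : ℝ, s ^ n * (1 / (1 + y) ^ 2 * (((r : ℝ) + 1) * (v * (s / t)) ^ r)) =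
          1 / (1 + y) ^ 2 * ((r : ℝ) + 1) * v ^ r / t ^ r * s ^ (n + r) := fun s => by
        rw [mul_pow, div_pow, pow_add]
        ring
      simp only [h1]
      rw [intervalIntegral.integral_const_mul, integral_pow]
      push_cast
      have h2 : (0 : ℝ) < (n : ℝ) + 1 + r := by positivity
      have h3 : (0 : ℝ) < (n : ℝ) + r + 1 := by positivity
      rw [pow_succ t (n + r), pow_add]
      simp only [ne_eq, Nat.add_eq_zero_iff, one_ne_zero, and_false, not_false_eq_true, zero_pow, sub_zero]
      field_simp
      ring
    simp only [hval] at hint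
    have h4 := ((hasSum_geometric_of_lt_one hv0 hv1).sub
      ((hasSum_ordinaryHypergeometric_one (a := (n : ℝ) + 1) (by positivity) hva).mul_left
        ((n : ℝ) / (n + 1)))).mul_left (t ^ (n + 1) / (1 + y) ^ 2)
    rw [hint.unique h4, show (n : ℝ) + 1 + 1 = n + 2 by ring]
    have h5 : (1 - v)⁻¹ = 1 + y := by
      rw [hv]
      simp
    rw [h5]
    field_simp
  · rw [abs_mul, abs_pow, abs_of_nonneg hs.1]
    have h1 : 0 ≤ v * (s / t) := mul_nonneg hv0 (div_nonneg hs.1 ht)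
    rw [abs_of_nonneg (by positivity)]
    have h2 : v * (s / t) ≤ v := mul_le_of_le_one_right hv0 ((div_le_one htpos).mpr hs.2)
    have := hs.1
    have := hs.2
    gcongr
  · have hu0 : 0 ≤ s / t := div_nonneg hs.1 ht
    have hu1 : s / t ≤ 1 := (div_le_one htpos).mpr hs.2
    have h1 : |v * (s / t)| < 1 := by
      rw [abs_of_nonneg (mul_nonneg hv0 hu0)]
      exact (mul_le_of_le_one_right hv0 hu1).trans_lt hv1
    have h2 := ((hasSum_succ_mul_pow h1).mul_left (1 / (1 + y) ^ 2)).mul_left (s ^ n)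
    have h3 : 1 - v * (s / t) = (1 + c * (t - s)) / (1 + y) := by
      rw [hv', hyd]
      field_simp
      ring
    have h4 : 0 < 1 + c * (t - s) := by
      have := mul_nonneg hc (sub_nonneg.mpr hs.2)
      linarith
    rw [h3] at h2
    refine hasSum_of_eq h2 (fun _ => rfl) ?_
    field_simp

/-- The distribution at time `τ` of the critical birth and death process with immigration. -/
noncomputable def critProb (k : ℕ) (τ : ℝ) : ℝ := τ ^ k / (1 + τ) ^ (k + 1)

theorem critProb_nonneg {τ : ℝ} (hτ : 0 ≤ τ) (k : ℕ) : 0 ≤ critProb k τ := by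
  rw [critProb]
  positivity

theorem critProb_le_one {τ : ℝ} (hτ : 0 ≤ τ) (k : ℕ) : critProb k τ ≤ 1 := by
  rw [critProb, div_le_one (by positivity)]
  calc τ ^ k ≤ (1 + τ) ^ k := by gcongr; linarith
    _ ≤ (1 + τ) ^ (k + 1) := pow_le_pow_right₀ (by linarith) (by omega)

theorem hasSum_pow_mul_critProb {z τ : ℝ} (hz : |z| < 1) (hτ : 0 ≤ τ) :
    HasSum (fun k : ℕ => z ^ k * critProb k τ) (1 / (1 + τ * (1 - z))) := by
  have h1 : |z * (τ / (1 + τ))| < 1 := by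
    rw [abs_mul, abs_of_nonneg (by positivity : 0 ≤ τ / (1 + τ))]
    refine (mul_le_of_le_one_right (abs_nonneg z) ?_).trans_lt hz
    exact (div_le_one (by positivity)).mpr (by linarith)
  have h2 := (hasSum_geometric_of_norm_lt_one (ξ := z * (τ / (1 + τ))) h1).mul_left (1 / (1 + τ))
  have h4 : 0 < 1 + τ * (1 - z) := by
    have := mul_nonneg hτ (by linarith [(abs_lt.mp hz).2] : 0 ≤ 1 - z)
    linarith
  refine hasSum_of_eq (h2) (fun k => ?_) ?_
  · rw [critProb, mul_pow, div_pow, pow_succ]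
    field_simp
  · rw [show 1 - z * (τ / (1 + τ)) = (1 + τ * (1 - z)) / (1 + τ) by field_simp; ring]
    field_simp

theorem continuousOn_critProb {lam t : ℝ} (hlam : 0 ≤ lam) (k : ℕ) :
    ContinuousOn (fun s => critProb k (lam * (t - s))) (Set.Icc 0 t) := by
  refine ContinuousOn.div (by fun_prop) (by fun_prop) fun s hs => ?_
  have := mul_nonneg hlam (sub_nonneg.mpr hs.2)
  positivity

/-- The Pochhammer quotient is `n/(n+r)`, that is `n t^(-n) ∫₀ᵗ s^(n-1) (s/t)^r ds`. Under the
integral the sum over `r` is `hasSum_pow_mul_hypergeometric` with `q = v s/t`. The argument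
`-1/(λt)` makes the numerator base `(t-s)/t`, so the result is proportional to `critProb k
(λ(t-s))`. -/
theorem hasSum_hypergeometric_coeff {lam t : ℝ} (hlam : 0 < lam) (ht : 0 < t) {n : ℕ} (hn : 0 < n)
    (k : ℕ) :
    HasSum (fun r : ℕ =>
      (ascPochhammer ℝ r).eval (n : ℝ) / (ascPochhammer ℝ r).eval ((n : ℝ) + 1) *
        (1 - 1 / (1 + lam * t)) ^ r *
        ordinaryHypergeometric (-(r : ℝ)) (-(k : ℝ)) 1 (-(1 / (lam * t))))
      ((1 + lam * t) ^ (k + 1) / (lam * t) ^ k / t ^ n *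
        (n * ∫ s in (0 : ℝ)..t, s ^ (n - 1) * critProb k (lam * (t - s)))) := by
  obtain ⟨m, rfl⟩ : ∃ m, n = m + 1 := ⟨n - 1, by omega⟩
  have hx : 0 < lam * t := by positivity
  set x := lam * t with hxd
  set v := 1 - 1 / (1 + x) with hv
  have hv' : v = x / (1 + x) := by rw [hv]; field_simp; ring
  have hv0 : 0 ≤ v := by rw [hv']; positivity
  have hv1 : v < 1 := by
    have : 0 < 1 / (1 + x) := by positivity
    linarith
  set c : ℕ → ℝ := fun r => v ^ r * ordinaryHypergeometric (-(r : ℝ)) (-(k : ℝ)) 1 (-(1 / x)) with hc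
  have hcsum : Summable fun r => |c r| :=
    (hasSum_pow_mul_hypergeometric (q := v) (y := -(1 / x)) (by rwa [abs_of_nonneg hv0])
      k).summable.abs
  have hint := hasSum_intervalIntegral_of_bound (t := t)
    (F := fun (r : ℕ) s => s ^ m * ((s / t) ^ r * c r))
    (f := fun s => (1 + x) ^ (k + 1) / x ^ k * (s ^ m * critProb k (lam * (t - s))))
    (b := fun r => t ^ m * |c r|) ht.le
    (fun r => by fun_prop) (fun r s hs => ?_) (hcsum.mul_left _)
    (fun s hs => ?_)
  · rw [intervalIntegral.integral_const_mul] at hint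
    refine hasSum_of_eq (hint.mul_left (((m + 1 : ℕ) : ℝ) / t ^ (m + 1))) (fun r => ?_) ?_
    · rw [ascPochhammer_eval_div_eval_add_one (by positivity)]
      have h1 : ∀ s : ℝ, s ^ m * ((s / t) ^ r * c r) = c r / t ^ r * s ^ (m + r) := fun s => by
        rw [div_pow, pow_add]
        ring
      simp only [h1]
      rw [intervalIntegral.integral_const_mul, integral_pow, mul_assoc]
      change _ * c r = _
      have h2 : (0 : ℝ) < (m : ℝ) + 1 + r := by positivity
      have h3 : (0 : ℝ) < (m : ℝ) + r + 1 := by positivity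
      push_cast
      simp only [ne_eq, Nat.add_eq_zero_iff, one_ne_zero, and_false, not_false_eq_true, zero_pow,
        sub_zero]
      rw [show t ^ (m + r + 1) = t ^ (m + 1) * t ^ r by rw [← pow_add]; ring_nf]
      field_simp
      ring
    · rw [Nat.add_sub_cancel]
      ring
  · rw [abs_mul, abs_mul, abs_pow, abs_pow, abs_of_nonneg hs.1,
      abs_of_nonneg (div_nonneg hs.1 ht.le)]
    have h1 : (s / t) ^ r ≤ 1 := pow_le_one₀ (div_nonneg hs.1 ht.le) ((div_le_one ht).mpr hs.2)
    have h2 : s ^ m ≤ t ^ m := pow_le_pow_left₀ hs.1 hs.2 m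
    exact mul_le_mul h2 (mul_le_of_le_one_left (abs_nonneg _) h1)
      (mul_nonneg (pow_nonneg (div_nonneg hs.1 ht.le) _) (abs_nonneg _)) (by positivity)
  · have hu0 : 0 ≤ s / t := div_nonneg hs.1 ht.le
    have hu1 : s / t ≤ 1 := (div_le_one ht).mpr hs.2
    have h1 : |v * (s / t)| < 1 := by
      rw [abs_of_nonneg (mul_nonneg hv0 hu0)]
      exact (mul_le_of_le_one_right hv0 hu1).trans_lt hv1
    have h2 := (hasSum_pow_mul_hypergeometric (y := -(1 / x)) h1 k).mul_left (s ^ m)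
    have h4 : 0 < 1 + lam * (t - s) := by
      have := mul_nonneg hlam.le (sub_nonneg.mpr hs.2)
      linarith
    have h3 : 1 - v * (s / t) = (1 + lam * (t - s)) / (1 + x) := by
      rw [hv', hxd]
      field_simp
      ring
    have h5 : 1 - v * (s / t) + v * (s / t) * -(1 / x) = lam * (t - s) / x := by
      rw [hv', hxd]
      field_simp
      ring
    rw [h5, h3] at h2
    refine hasSum_of_eq (h2) (fun r => ?_) ?_
    · rw [hc, mul_pow]
      ring
    · rw [critProb, div_pow, div_pow]
      field_simp

theorem eq_of_hasSum_pow_mul {a b : ℕ → ℝ} {F : ℝ → ℝ}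
    (ha : ∀ z : ℝ, |z| < 1 → HasSum (fun k : ℕ => z ^ k * a k) (F z))
    (hb : ∀ z : ℝ, |z| < 1 → HasSum (fun k : ℕ => z ^ k * b k) (F z)) : a = b := by
  have key : ∀ c : ℕ → ℝ, (∀ z : ℝ, |z| < 1 → HasSum (fun k : ℕ => z ^ k * c k) (F z)) →
      HasFPowerSeriesAt F (FormalMultilinearSeries.ofScalars ℝ c) 0 := by
    intro c hc
    rw [hasFPowerSeriesAt_iff]
    filter_upwards [Metric.ball_mem_nhds (0 : ℝ) one_pos] with z hz
    simp only [FormalMultilinearSeries.coeff_ofScalars, smul_eq_mul, zero_add]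
    exact hc z (by simpa using hz)
  have h := (key a ha).eq_formalMultilinearSeries (key b hb)
  funext k
  have := congrArg (fun p => p.coeff k) h
  simpa [FormalMultilinearSeries.coeff_ofScalars] using this

/-- The weight of `critProb k` in the probability of being at distance `k`, for the `n`-th term
of the power series of the probability of being at the origin. -/
noncomputable def critMoment (lam t : ℝ) (n k : ℕ) : ℝ :=
  n * ∫ s in (0 : ℝ)..t, s ^ (n - 1) * critProb k (lam * (t - s))

theorem abs_critMoment_le {lam t : ℝ} (hlam : 0 ≤ lam) (ht : 0 ≤ t) (n k : ℕ) :
    |critMoment lam t n k| ≤ t ^ n := by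
  rcases Nat.eq_zero_or_pos n with rfl | hn
  · simp [critMoment]
  have hmem : ∀ s ∈ Set.Icc 0 t, 0 ≤ lam * (t - s) := fun s hs =>
    mul_nonneg hlam (sub_nonneg.mpr hs.2)
  have h0 : 0 ≤ ∫ s in (0 : ℝ)..t, s ^ (n - 1) * critProb k (lam * (t - s)) :=
    intervalIntegral.integral_nonneg ht fun s hs =>
      mul_nonneg (pow_nonneg hs.1 _) (critProb_nonneg (hmem s hs) k)
  have h1 : ∫ s in (0 : ℝ)..t, s ^ (n - 1) * critProb k (lam * (t - s)) ≤
      ∫ s in (0 : ℝ)..t, s ^ (n - 1) := by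
    refine intervalIntegral.integral_mono_on ht ?_
      (Continuous.intervalIntegrable (by fun_prop) _ _) fun s hs =>
        mul_le_of_le_one_right (pow_nonneg hs.1 _) (critProb_le_one (hmem s hs) k)
    apply ContinuousOn.intervalIntegrable_of_Icc ht
    exact ContinuousOn.mul (by fun_prop) (continuousOn_critProb hlam k)
  rw [critMoment, abs_of_nonneg (by positivity)]
  refine (mul_le_mul_of_nonneg_left h1 (by positivity)).trans (le_of_eq ?_)
  obtain ⟨m, rfl⟩ : ∃ m, n = m + 1 := ⟨n - 1, by omega⟩
  rw [integral_pow]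
  push_cast
  field_simp
  simp

theorem hasSum_pow_mul_critMoment {lam t z : ℝ} (hlam : 0 ≤ lam) (ht : 0 ≤ t) (hz : |z| < 1)
    (n : ℕ) :
    HasSum (fun k : ℕ => z ^ k * critMoment lam t n k)
      (n * ∫ s in (0 : ℝ)..t, s ^ (n - 1) * (1 / (1 + lam * (1 - z) * (t - s)))) := by
  have hint := hasSum_intervalIntegral_of_bound (t := t)
    (F := fun (k : ℕ) s => s ^ (n - 1) * (z ^ k * critProb k (lam * (t - s))))
    (f := fun s => s ^ (n - 1) * (1 / (1 + lam * (1 - z) * (t - s))))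
    (b := fun k => t ^ (n - 1) * |z| ^ k) ht
    (fun k => ContinuousOn.mul (by fun_prop)
      (ContinuousOn.mul (by fun_prop) (continuousOn_critProb hlam k)))
    (fun k s hs => ?_) ((summable_geometric_of_lt_one (abs_nonneg z) hz).mul_left _)
    (fun s hs => ?_)
  · refine hasSum_of_eq (hint.mul_left (n : ℝ)) (fun k => ?_) rfl
    rw [critMoment, mul_left_comm, ← intervalIntegral.integral_const_mul]
    congr 1
    exact intervalIntegral.integral_congr fun s _ => by ring
  · have hτ : 0 ≤ lam * (t - s) := mul_nonneg hlam (sub_nonneg.mpr hs.2)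
    rw [abs_mul, abs_mul, abs_pow, abs_pow, abs_of_nonneg hs.1,
      abs_of_nonneg (critProb_nonneg hτ k)]
    exact mul_le_mul (pow_le_pow_left₀ hs.1 hs.2 _)
      (mul_le_of_le_one_right (by positivity) (critProb_le_one hτ k))
      (mul_nonneg (by positivity) (critProb_nonneg hτ k)) (by positivity)
  · have hτ : 0 ≤ lam * (t - s) := mul_nonneg hlam (sub_nonneg.mpr hs.2)
    refine hasSum_of_eq ((hasSum_pow_mul_critProb hz hτ).mul_left (s ^ (n - 1))) (fun _ => rfl) ?_
    rw [show lam * (1 - z) * (t - s) = lam * (t - s) * (1 - z) by ring]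

/-- Integration by parts, as `c/(1+c(t-s))²` is the derivative of `1/(1+c(t-s))`. The boundary term
at `s = 0` survives only for `n = 0`, hence `0 ^ n`. -/
theorem mul_integral_pow_div_sq {c t : ℝ} (hc : 0 ≤ c) (ht : 0 ≤ t) (n : ℕ) :
    c * ∫ s in (0 : ℝ)..t, s ^ n / (1 + c * (t - s)) ^ 2 =
      t ^ n - 0 ^ n / (1 + c * t) -
        n * ∫ s in (0 : ℝ)..t, s ^ (n - 1) * (1 / (1 + c * (t - s))) := by
  have hpos : ∀ s ∈ Set.uIcc 0 t, 1 + c * (t - s) ≠ 0 := fun s hs => by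
    rw [Set.uIcc_of_le ht] at hs
    have := mul_nonneg hc (sub_nonneg.mpr hs.2)
    positivity
  have h := intervalIntegral.integral_mul_deriv_eq_deriv_mul (a := 0) (b := t)
    (u := fun s => s ^ n) (u' := fun s => n * s ^ (n - 1))
    (v := fun s => 1 / (1 + c * (t - s))) (v' := fun s => c / (1 + c * (t - s)) ^ 2)
    (fun s _ => hasDerivAt_pow n s)
    (fun s hs => by
      have h1 : HasDerivAt (fun s => 1 + c * (t - s)) (c * (-1)) s :=
        (((hasDerivAt_id s).const_sub t).const_mul c).const_add 1
      refine ((hasDerivAt_const s (1 : ℝ)).div h1 (hpos s hs)).congr_deriv ?_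
      ring)
    (Continuous.intervalIntegrable (by fun_prop) _ _)
    (ContinuousOn.intervalIntegrable (ContinuousOn.div (by fun_prop) (by fun_prop)
      fun s hs => pow_ne_zero 2 (hpos s hs)))
  have e1 : c * ∫ s in (0 : ℝ)..t, s ^ n / (1 + c * (t - s)) ^ 2 =
      ∫ s in (0 : ℝ)..t, s ^ n * (c / (1 + c * (t - s)) ^ 2) := by
    rw [← intervalIntegral.integral_const_mul]
    exact intervalIntegral.integral_congr fun s _ => by ring
  have e2 : n * ∫ s in (0 : ℝ)..t, s ^ (n - 1) * (1 / (1 + c * (t - s))) =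
      ∫ s in (0 : ℝ)..t, n * s ^ (n - 1) * (1 / (1 + c * (t - s))) := by
    rw [← intervalIntegral.integral_const_mul]
    exact intervalIntegral.integral_congr fun s _ => by ring
  rw [e1, e2, h]
  simp [div_eq_mul_inv]

theorem hasSum_pnat_of_hasSum {f : ℕ → ℝ} {a : ℝ} (h : HasSum f a) :
    HasSum (fun n : ℕ+ => f n) (a - f 0) :=
  hasSum_pnat_iff.mpr (by rwa [sub_add_cancel])

/-! ### Series for the probabilities of the walk. -/

namespace IsStarTransition

variable {d : ℕ} {lam : ℝ} {P : ℝ → StarState d → StarState d → ℝ}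

theorem hasSum_pow_mul_level (hP : IsStarTransition d lam lam lam P) {t z : ℝ} (ht : 0 ≤ t)
    (hz : |z| ≤ 1) :
    HasSum (fun k : ℕ+ => z ^ (k : ℕ) * ∑ j, P t none (some (j, k)))
      (starExpect P t (fun v => z ^ starLevel v) none - P t none none) := by
  classical
  have h1 := (hP.summable_mul ht (f := fun v => z ^ starLevel v) (B := 1) (fun v => by
    rw [abs_pow]
    exact pow_le_one₀ (abs_nonneg z) hz) none).hasSum
  have h2 := h1.sub (hasSum_ite_eq (none : StarState d) (P t none none))
  have h3 := (Function.Injective.hasSum_iff (Option.some_injective (Fin d × ℕ+)) (by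
    rintro (_ | v) hv
    · simp [starLevel]
    · exact absurd ⟨v, rfl⟩ hv)).mpr h2
  have h4 := ((Equiv.prodComm ℕ+ (Fin d)).hasSum_iff.mpr h3).prod_fiberwise
    fun k => hasSum_fintype _
  refine hasSum_of_eq h4 (fun k => ?_) rfl
  rw [Finset.mul_sum]
  refine Finset.sum_congr rfl fun j _ => ?_
  simp [starLevel, mul_comm]

theorem apply_none_none (hP : IsStarTransition d lam lam lam P) (hlam : 0 ≤ lam) {t : ℝ}
    (hlt : lam * t < 1) :
    Set.EqOn (fun s => P s none none) (fun s => permSeries d (-(lam * s))) (Set.Icc 0 t) := by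
  have hden : ∀ s ∈ Set.Icc 0 t, 1 ≤ 1 + lam * s := fun s hs => by
    have := mul_nonneg hlam hs.1
    linarith
  refine eqOn_of_volterra (a := fun s => 1 / (1 + lam * s)) (c := -((d - 1) * lam))
    (k := fun s => 1 / (1 + lam * s) ^ 2)
    ((hP.continuousOn_apply none none).mono Set.Icc_subset_Ici_self)
    (continuousOn_permSeries d hlam hlt) (ContinuousOn.div (by fun_prop) (by fun_prop)
      fun s hs => ?_) (fun s hs => ?_) (fun s hs => ?_) (fun s hs => ?_)
  · have := hden s hs
    positivity
  · have := hden s hs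
    rw [abs_of_nonneg (by positivity)]
    exact (div_le_one (by positivity)).mpr (one_le_pow₀ this)
  -- At `w = 1` the function `(1 - w) ^ level` is the indicator of the origin, so Duhamel's formula
  -- closes up into an equation for `P s none none`.
  · have h := hP.expect_pow_level hlam (w := 1) zero_le_one (by norm_num) hs.1
    have h0 : starExpect P s (fun v => (1 - 1 : ℝ) ^ starLevel v) none = P s none none := by
      rw [starExpect, tsum_eq_single none]
      · simp [starLevel]
      · rintro (_ | ⟨i, k⟩) hv
        · exact absurd rfl hv
        · simp [starLevel]
    rw [h0] at h
    simp only [mul_one] at h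
    rw [h]
    simp only [div_eq_mul_inv, one_mul]
    ring
  · exact permSeries_volterra d hlam hs.1 ((mul_le_mul_of_nonneg_left hs.2 hlam).trans_lt hlt)

theorem hasSum_integral (hP : IsStarTransition d lam lam lam P) (hlam : 0 ≤ lam) {t w : ℝ}
    (ht : 0 ≤ t) (hlt : lam * t < 1) (hw : 0 ≤ w) :
    HasSum (fun n : ℕ => (-lam) ^ n / (n.factorial : ℝ) * permSum d n *
        ∫ s in (0 : ℝ)..t, s ^ n / (1 + lam * w * (t - s)) ^ 2)
      (∫ s in (0 : ℝ)..t, P s none none / (1 + lam * w * (t - s)) ^ 2) := by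
  have hden : ∀ s ∈ Set.Icc 0 t, 1 ≤ 1 + lam * w * (t - s) := fun s hs =>
    one_le_critDenom hlam hw (sub_nonneg.mpr hs.2)
  have hx : ∀ s ∈ Set.Icc 0 t, |(-(lam * s))| ≤ lam * t := fun s hs => by
    rw [abs_neg, abs_of_nonneg (mul_nonneg hlam hs.1)]
    exact mul_le_mul_of_nonneg_left hs.2 hlam
  have hint := hasSum_intervalIntegral_of_bound (t := t)
    (F := fun (n : ℕ) s => (-(lam * s)) ^ n / (n.factorial : ℝ) * permSum d n *
      (1 / (1 + lam * w * (t - s)) ^ 2))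
    (f := fun s => P s none none / (1 + lam * w * (t - s)) ^ 2)
    (b := fun n => (lam * t) ^ n / (n.factorial : ℝ) * permSum d n) ht
    (fun n => ContinuousOn.mul (by fun_prop) (ContinuousOn.div (by fun_prop) (by fun_prop)
      fun s hs => by have := hden s hs; positivity)) (fun n s hs => ?_)
    (summable_permSum d (mul_nonneg hlam ht) hlt) (fun s hs => ?_)
  · refine hasSum_of_eq hint (fun n => ?_) rfl
    rw [← intervalIntegral.integral_const_mul]
    refine intervalIntegral.integral_congr fun s _ => ?_
    simp only [← neg_mul, mul_pow]
    ring
  · have := hden s hs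
    rw [abs_mul, abs_of_nonneg (by positivity : 0 ≤ 1 / (1 + lam * w * (t - s)) ^ 2)]
    exact (mul_le_of_le_one_right (abs_nonneg _) ((div_le_one (by positivity)).mpr
      (one_le_pow₀ this))).trans (abs_permTerm_le d (hx s hs) n)
  · have h1 := (permSeries_hasSum d ((hx s hs).trans_lt hlt)).mul_right
      (1 / (1 + lam * w * (t - s)) ^ 2)
    refine hasSum_of_eq h1 (fun _ => rfl) ?_
    have h2 : P s none none = permSeries d (-(lam * s)) := hP.apply_none_none hlam hlt hs
    rw [h2]
    ring

/-- Subtracting the multiple of `permSeries` removes the non-hypergeometric part of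
`integral_pow_div_sq` in each term. The factor `n` kills the term `n = 0`, so the sum may start at
`1`. -/
theorem hasSum_genFun_series (hP : IsStarTransition d lam lam lam P) (hlam : 0 < lam) {t w : ℝ}
    (ht : 0 < t) (hlt : lam * t < 1) (hw : 0 ≤ w) :
    HasSum (fun n : ℕ =>
        (n : ℝ) * ((-(lam * t)) ^ (n + 1) / ((n + 1).factorial : ℝ)) *
          ordinaryHypergeometric (1 : ℝ) ((n : ℝ) + 1) ((n : ℝ) + 2)
            (1 - 1 / (1 + lam * t * w)) * permSum d n)
      (lam * (1 + lam * t * w) ^ 2 *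
        ((∫ s in (0 : ℝ)..t, P s none none / (1 + lam * w * (t - s)) ^ 2) -
          t / (1 + lam * t * w) * permSeries d (-(lam * t)))) := by
  have h1 := hP.hasSum_integral hlam.le ht.le hlt hw
  have h2 := permSeries_hasSum d (x := -(lam * t)) (by
    rwa [abs_neg, abs_of_pos (by positivity)])
  have hy : 0 < 1 + lam * t * w := by positivity
  refine hasSum_of_eq ((h1.sub (h2.mul_left (t / (1 + lam * t * w)))).mul_left
    (lam * (1 + lam * t * w) ^ 2)) (fun n => ?_) rfl
  rw [integral_pow_div_sq (by positivity) ht.le, show lam * w * t = lam * t * w by ring]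
  set H := ordinaryHypergeometric (1 : ℝ) ((n : ℝ) + 1) ((n : ℝ) + 2)
    (1 - 1 / (1 + lam * t * w))
  rw [Nat.factorial_succ, ← neg_mul, mul_pow, mul_pow]
  push_cast
  have : (n.factorial : ℝ) ≠ 0 := by positivity
  field_simp
  ring

theorem expect_pow_level_eq_tsum (hP : IsStarTransition d lam lam lam P) (hlam : 0 ≤ lam)
    {t z : ℝ} (ht : 0 ≤ t) (hlt : lam * t < 1) (hz : |z| < 1) :
    HasSum (fun n : ℕ => (-lam) ^ n / (n.factorial : ℝ) * permSum d n *
        (n * ∫ s in (0 : ℝ)..t, s ^ (n - 1) * (1 / (1 + lam * (1 - z) * (t - s)))))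
      (permSeries d (-(lam * t)) - 1 / (1 + lam * (1 - z) * t) - lam * (1 - z) *
        ∫ s in (0 : ℝ)..t, P s none none / (1 + lam * (1 - z) * (t - s)) ^ 2) := by
  have hw : 0 ≤ 1 - z := by linarith [(abs_lt.mp hz).2]
  have hc : 0 ≤ lam * (1 - z) := mul_nonneg hlam hw
  have h1 := (hP.hasSum_integral hlam ht hlt hw).mul_left (lam * (1 - z))
  have h2 := permSeries_hasSum d (x := -(lam * t)) (by
    rwa [abs_neg, abs_of_nonneg (by positivity)])
  have h3 := hasSum_ite_eq (0 : ℕ) (1 / (1 + lam * (1 - z) * t))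
  refine hasSum_of_eq ((h2.sub h3).sub h1) (fun n => ?_) rfl
  have h4 := mul_integral_pow_div_sq hc ht n
  set I := ∫ s in (0 : ℝ)..t, s ^ n / (1 + lam * (1 - z) * (t - s)) ^ 2
  set J := n * ∫ s in (0 : ℝ)..t, s ^ (n - 1) * (1 / (1 + lam * (1 - z) * (t - s)))
  have h5 : J = t ^ n - 0 ^ n / (1 + lam * (1 - z) * t) - lam * (1 - z) * I := by linarith
  rw [h5, ← neg_mul, mul_pow]
  rcases Nat.eq_zero_or_pos n with rfl | hn
  · simp only [pow_zero, Nat.factorial_zero, permSum_zero, if_true, Nat.cast_one]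
    ring
  · rw [if_neg hn.ne', zero_pow hn.ne']
    ring

theorem summable_permSum_mul_critMoment (hlam : 0 ≤ lam) {t : ℝ} (ht : 0 ≤ t)
    (hlt : lam * t < 1) (d k : ℕ) :
    Summable fun n : ℕ => (-lam) ^ n / (n.factorial : ℝ) * permSum d n * critMoment lam t n k := by
  refine Summable.of_norm_bounded (summable_permSum d (mul_nonneg hlam ht) hlt) fun n => ?_
  have h0 := permSum_nonneg (Nat.cast_nonneg (α := ℝ) d) n
  have h1 := abs_critMoment_le hlam ht n k
  rw [norm_mul, norm_mul, norm_div, norm_pow, norm_neg, Real.norm_of_nonneg hlam,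
    Real.norm_of_nonneg h0, Real.norm_of_nonneg (by positivity : (0 : ℝ) ≤ n.factorial),
    Real.norm_eq_abs]
  calc lam ^ n / (n.factorial : ℝ) * permSum d n * |critMoment lam t n k|
      ≤ lam ^ n / (n.factorial : ℝ) * permSum d n * t ^ n := by gcongr
    _ = _ := by rw [mul_pow]; ring

/-- Exchange of the sums over `n` and `k`, dominated by the product of the permutation series at
`λt` and a geometric series in `|z|`. -/
theorem hasSum_pow_mul_tsum_critMoment (hlam : 0 ≤ lam) {t z S : ℝ} (ht : 0 ≤ t)
    (hlt : lam * t < 1) (hz : |z| < 1) (d : ℕ)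
    (hS : HasSum (fun n : ℕ => (-lam) ^ n / (n.factorial : ℝ) * permSum d n *
        (n * ∫ s in (0 : ℝ)..t, s ^ (n - 1) * (1 / (1 + lam * (1 - z) * (t - s))))) S) :
    HasSum (fun k : ℕ => z ^ k * ∑' n : ℕ, (-lam) ^ n / (n.factorial : ℝ) * permSum d n *
      critMoment lam t n k) S := by
  set α : ℕ → ℝ := fun n => (-lam) ^ n / (n.factorial : ℝ) * permSum d n with hα
  have hb : Summable fun p : ℕ × ℕ => ((lam * t) ^ p.1 / (p.1.factorial : ℝ) * permSum d p.1) *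
      |z| ^ p.2 :=
    (summable_permSum d (mul_nonneg hlam ht) hlt).mul_of_nonneg
      (summable_geometric_of_lt_one (abs_nonneg z) hz)
      (fun n => mul_nonneg (by positivity) (permSum_nonneg (by positivity) n))
      (fun n => by positivity)
  have hG : Summable fun p : ℕ × ℕ => α p.1 * (z ^ p.2 * critMoment lam t p.1 p.2) := by
    refine Summable.of_norm_bounded hb fun p => ?_
    have h0 := permSum_nonneg (Nat.cast_nonneg (α := ℝ) d) p.1
    have h1 := abs_critMoment_le hlam ht p.1 p.2
    rw [hα, norm_mul, norm_mul, norm_div, norm_pow, norm_neg, Real.norm_of_nonneg hlam,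
      Real.norm_of_nonneg h0, Real.norm_of_nonneg (by positivity : (0 : ℝ) ≤ p.1.factorial),
      norm_mul, norm_pow, Real.norm_eq_abs, Real.norm_eq_abs]
    calc lam ^ p.1 / (p.1.factorial : ℝ) * permSum d p.1 *
          (|z| ^ p.2 * |critMoment lam t p.1 p.2|)
        ≤ lam ^ p.1 / (p.1.factorial : ℝ) * permSum d p.1 * (|z| ^ p.2 * t ^ p.1) := by gcongr
      _ = _ := by rw [mul_pow]; ring
  have h1 := hG.hasSum.prod_fiberwise fun n =>
    (hasSum_pow_mul_critMoment hlam ht hz n).mul_left (α n)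
  have h2 := h1.unique hS
  have h3 := ((Equiv.prodComm ℕ ℕ).hasSum_iff.mpr hG.hasSum).prod_fiberwise fun k =>
    hasSum_of_eq (((summable_permSum_mul_critMoment hlam ht hlt d k).hasSum).mul_left (z ^ k))
      (fun n => by simp only [Function.comp_apply, Equiv.prodComm_apply, Prod.swap, hα]; ring) rfl
  rwa [h2] at h3

theorem level_eq (hP : IsStarTransition d lam lam lam P) (hlam : 0 ≤ lam)
    {t : ℝ} (ht : 0 ≤ t) (hlt : lam * t < 1) (k : ℕ+) :
    ∑ j, P t none (some (j, k)) = d * critProb k (lam * t) + (d - 1) *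
      ∑' n : ℕ, (-lam) ^ n / (n.factorial : ℝ) * permSum d n * critMoment lam t n k := by
  have h := eq_of_hasSum_pow_mul
    (a := fun k : ℕ => if hk : 0 < k then ∑ j, P t none (some (j, ⟨k, hk⟩)) else P t none none)
    -- Eliminating the integral between Duhamel's formula and `expect_pow_level_eq_tsum` leaves the
    -- constant `-(d - 1) permSeries`, independent of `z`; it affects only the coefficient `k = 0`.
    (b := fun k : ℕ => d * critProb k (lam * t) + (d - 1) *
      (∑' n : ℕ, (-lam) ^ n / (n.factorial : ℝ) * permSum d n * critMoment lam t n k) -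
        if k = 0 then (d - 1) * permSeries d (-(lam * t)) else 0)
    (F := fun z => starExpect P t (fun v => z ^ starLevel v) none)
    (fun z hz => ?_) (fun z hz => ?_)
  · have := congrFun h k
    simp only [dif_pos k.pos, if_neg k.ne_zero, sub_zero] at this
    exact this
  · have h1 := hP.hasSum_pow_mul_level ht hz.le
    have h2 := (hasSum_pnat_iff (f := fun k : ℕ => z ^ k * if hk : 0 < k then
      ∑ j, P t none (some (j, ⟨k, hk⟩)) else P t none none)).mp
        (hasSum_of_eq h1 (fun k => by rw [dif_pos k.pos]; rfl) rfl)
    simpa using h2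
  · have hz2 := abs_lt.mp hz
    have h1 := hP.expect_pow_level hlam (w := 1 - z) (by linarith) (by linarith) ht
    rw [sub_sub_cancel] at h1
    have h2 := hasSum_pow_mul_tsum_critMoment hlam ht hlt hz d
      (hP.expect_pow_level_eq_tsum hlam ht hlt hz)
    have h3 := hasSum_pow_mul_critProb hz (mul_nonneg hlam ht)
    have h4 := hasSum_ite_eq (0 : ℕ) ((d - 1) * permSeries d (-(lam * t)))
    refine hasSum_of_eq (((h3.mul_left (d : ℝ)).add (h2.mul_left ((d : ℝ) - 1))).sub h4)
      (fun k => ?_) ?_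
    · rcases Nat.eq_zero_or_pos k with rfl | hk
      · simp
      · simp only [if_neg hk.ne']
        ring
    · rw [h1, show lam * t * (1 - z) = lam * (1 - z) * t by ring]
      ring

end IsStarTransition

/-! ### From the process to the transition function, and the theorem. -/

namespace IsStarWalk

variable {d : ℕ} {al lam mu : ℝ} {Ω : Type*} [MeasurableSpace Ω]

theorem exists_transition {ℙ : Measure Ω} [IsProbabilityMeasure ℙ] {N : ℝ → Ω → StarState d}
    (hN : IsStarWalk d al lam mu ℙ N) :
    ∃ P, IsStarTransition d al lam mu P ∧
      ∀ t, 0 ≤ t → ∀ v, walkProb ℙ N v t = P t none v := by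
  obtain ⟨P, hP, hmarkov⟩ := hN.markov
  refine ⟨P, hP, fun t ht v => ?_⟩
  -- The Markov property at time `0` with an empty past; the conditioning event has probability one
  -- because the walk starts at the origin.
  have h := hmarkov 0 Fin.elim0 Fin.elim0 0 t none v (fun i => i.elim0) le_rfl ht
  have h1 : ℙ.real {ω | (∀ i : Fin 0, N (i.elim0) ω = i.elim0) ∧ N 0 ω = none} = 1 := by
    have : ({ω | (∀ i : Fin 0, N (i.elim0) ω = i.elim0) ∧ N 0 ω = none} : Set Ω) =ᵐ[ℙ]
        Set.univ := by
      filter_upwards [hN.start] with ω hω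
      exact propext (iff_of_true ⟨fun i => i.elim0, hω⟩ trivial)
    rw [measureReal_congr this]
    simp
  have h2 : ℙ.real {ω | (∀ i : Fin 0, N (i.elim0) ω = i.elim0) ∧ N 0 ω = none ∧
      N (0 + t) ω = v} = walkProb ℙ N v t := by
    refine measureReal_congr ?_
    filter_upwards [hN.start] with ω hω
    refine propext ⟨fun h => ?_, fun h => ⟨fun i => i.elim0, hω, ?_⟩⟩
    · have := h.2.2
      rwa [zero_add] at this
    · rw [zero_add]
      exact h
  rw [← h2, h, h1, one_mul]

end IsStarWalk

theorem mainTheorem8 {Ω : Type*} [MeasurableSpace Ω] (ℙ : Measure Ω) [IsProbabilityMeasure ℙ]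
    (d : ℕ) (al lam mu : ℝ) (hlam : 0 < lam) (hal : al = lam) (hmu : mu = lam)
    (N : ℝ → Ω → StarState d) (hN : IsStarWalk d al lam mu ℙ N)
    (t : ℝ) (ht0 : 0 < t) (ht1 : t < 1 / lam) :
    -- the generating function
    (∀ z : ℝ, 0 ≤ z → z ≤ 1 →
      Summable (fun k : ℕ+ => z ^ (k : ℕ) * levelProb ℙ N k t) ∧
      Summable (fun n : ℕ+ =>
        (-(lam * t)) ^ (n : ℕ) / ((n : ℕ).factorial : ℝ) * permPoly d n) ∧
      Summable (fun n : ℕ+ =>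
        (n : ℝ) * ((-(lam * t)) ^ ((n : ℕ) + 1) / (((n : ℕ) + 1).factorial : ℝ)) *
          ordinaryHypergeometric (1 : ℝ) ((n : ℝ) + 1) ((n : ℝ) + 2)
            (1 - 1 / (1 + lam * t * (1 - z))) * permPoly d n) ∧
      walkGenFun ℙ N z t =
        1 / (1 + lam * t * (1 - z))
        - lam * t * ((d : ℝ) - 1) * (1 - z) / (1 + lam * t * (1 - z)) *
          (1 + ∑' n : ℕ+,
            (-(lam * t)) ^ (n : ℕ) / ((n : ℕ).factorial : ℝ) * permPoly d n)
        - ((d : ℝ) - 1) * (1 - z) / (1 + lam * t * (1 - z)) ^ 2 *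
          ∑' n : ℕ+,
            (n : ℝ) * ((-(lam * t)) ^ ((n : ℕ) + 1) / (((n : ℕ) + 1).factorial : ℝ)) *
              ordinaryHypergeometric (1 : ℝ) ((n : ℝ) + 1) ((n : ℝ) + 2)
                (1 - 1 / (1 + lam * t * (1 - z))) * permPoly d n) ∧
    -- its coefficients
    (∀ k : ℕ+,
      (∀ n : ℕ+, Summable (fun r : ℕ =>
        (ascPochhammer ℝ r).eval (n : ℝ) / (ascPochhammer ℝ r).eval ((n : ℝ) + 1) * (1 - 1 / (1 + lam * t)) ^ r *
          ordinaryHypergeometric (-(r : ℝ)) (-(k : ℝ)) 1 (-(1 / (lam * t))))) ∧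
      Summable (fun n : ℕ+ =>
        (-(lam * t)) ^ (n : ℕ) / ((n : ℕ).factorial : ℝ) * permPoly d n *
          ∑' r : ℕ,
            (ascPochhammer ℝ r).eval (n : ℝ) / (ascPochhammer ℝ r).eval ((n : ℝ) + 1) * (1 - 1 / (1 + lam * t)) ^ r *
              ordinaryHypergeometric (-(r : ℝ)) (-(k : ℝ)) 1 (-(1 / (lam * t)))) ∧
      levelProb ℙ N k t =
        (lam * t) ^ (k : ℕ) / (lam * t + 1) ^ ((k : ℕ) + 1) *
          ((d : ℝ) + ((d : ℝ) - 1) *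
            ∑' n : ℕ+,
              (-(lam * t)) ^ (n : ℕ) / ((n : ℕ).factorial : ℝ) * permPoly d n *
                ∑' r : ℕ,
                  (ascPochhammer ℝ r).eval (n : ℝ) / (ascPochhammer ℝ r).eval ((n : ℝ) + 1) * (1 - 1 / (1 + lam * t)) ^ r *
                    ordinaryHypergeometric (-(r : ℝ)) (-(k : ℝ)) 1 (-(1 / (lam * t))))) := by
  -- From here on the common value of the three rates is called `mu`.
  obtain rfl := hal
  obtain rfl := hmu
  obtain ⟨P, hP, hwalk⟩ := hN.exists_transition
  have hx : 0 < mu * t := by positivity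
  have hlt : mu * t < 1 := by
    rw [lt_div_iff₀ hlam] at ht1
    linarith
  have hlevel : ∀ k : ℕ+, levelProb ℙ N k t = ∑ j, P t none (some (j, k)) := fun k =>
    Finset.sum_congr rfl fun j _ => hwalk t ht0.le _
  have hpoly : ∀ n : ℕ+, permPoly d n = permSum d n := fun n => permPoly_eq_permSum d n.pos
  refine ⟨fun z hz0 hz1 => ?_, fun k => ?_⟩
  · have hw : 0 ≤ 1 - z := by linarith
    have h1 : HasSum (fun k : ℕ+ => z ^ (k : ℕ) * levelProb ℙ N k t)
        (starExpect P t (fun v => z ^ starLevel v) none - P t none none) :=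
      hasSum_of_eq (hP.hasSum_pow_mul_level ht0.le (by rwa [abs_of_nonneg hz0]))
        (fun k => by rw [hlevel]) rfl
    have h2 := hasSum_pnat_of_hasSum (permSeries_hasSum d (x := -(mu * t))
      (by rwa [abs_neg, abs_of_pos hx]))
    have h4 := hasSum_pnat_of_hasSum (hP.hasSum_genFun_series hlam ht0 hlt hw)
    simp only [pow_zero, Nat.factorial_zero, Nat.cast_one, div_one, one_mul, permSum_zero] at h2
    simp only [Nat.cast_zero, zero_mul, sub_zero] at h4
    have h2' := hasSum_of_eq h2 (f := fun n : ℕ+ => (-(mu * t)) ^ (n : ℕ) /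
      ((n : ℕ).factorial : ℝ) * permPoly d n) (fun n => by rw [hpoly]) rfl
    have h4' := hasSum_of_eq h4 (f := fun n : ℕ+ => (n : ℝ) * ((-(mu * t)) ^ ((n : ℕ) + 1) /
      (((n : ℕ) + 1).factorial : ℝ)) * ordinaryHypergeometric (1 : ℝ) ((n : ℝ) + 1) ((n : ℝ) + 2)
        (1 - 1 / (1 + mu * t * (1 - z))) * permPoly d n) (fun n => by rw [hpoly]) rfl
    refine ⟨h1.summable, h2'.summable, h4'.summable, ?_⟩
    have h5 := hP.expect_pow_level hlam.le hw (by linarith) ht0.le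
    rw [sub_sub_cancel] at h5
    rw [walkGenFun, h1.tsum_eq, h2'.tsum_eq, h4'.tsum_eq, hwalk t ht0.le, add_sub_cancel, h5,
      show mu * (1 - z) * t = mu * t * (1 - z) by ring]
    have hy : 0 < 1 + mu * t * (1 - z) := by positivity
    field_simp
    ring
  · have hr : ∀ n : ℕ+, _ := fun n => hasSum_hypergeometric_coeff hlam ht0 n.pos (k : ℕ)
    have h1 : ∀ n : ℕ+, (-(mu * t)) ^ (n : ℕ) / ((n : ℕ).factorial : ℝ) * permPoly d n *
        ∑' r : ℕ, (ascPochhammer ℝ r).eval (n : ℝ) / (ascPochhammer ℝ r).eval ((n : ℝ) + 1) *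
          (1 - 1 / (1 + mu * t)) ^ r *
            ordinaryHypergeometric (-(r : ℝ)) (-(k : ℝ)) 1 (-(1 / (mu * t))) =
        (-mu) ^ (n : ℕ) / ((n : ℕ).factorial : ℝ) * permSum d n * critMoment mu t n k *
          ((1 + mu * t) ^ ((k : ℕ) + 1) / (mu * t) ^ (k : ℕ)) := by
      intro n
      rw [(hr n).tsum_eq, hpoly, ← neg_mul, mul_pow, critMoment]
      have : t ^ (n : ℕ) ≠ 0 := by positivity
      field_simp
    have h2 := hasSum_pnat_of_hasSum
      (IsStarTransition.summable_permSum_mul_critMoment hlam.le ht0.le hlt d k).hasSum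
    -- The term `n = 0` vanishes, so the series over `ℕ` and over `ℕ+` have the same sum.
    have h0 : critMoment mu t 0 k = 0 := by simp [critMoment]
    rw [h0, mul_zero, sub_zero] at h2
    have h3 := hasSum_of_eq (h2.mul_right
      ((1 + mu * t) ^ ((k : ℕ) + 1) / (mu * t) ^ (k : ℕ))) h1 rfl
    refine ⟨fun n => (hr n).summable, h3.summable, ?_⟩
    rw [h3.tsum_eq, hlevel, hP.level_eq hlam.le ht0.le hlt, critProb, add_comm (mu * t) 1]
    field_simp
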